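/- Let $\Gamma$ be an arbitrary Kleinian group, i.e. a discrete subgroup of $\mathrm{PSL}(2,\mathbb C)$, and let $\Gamma_1\lhd\Gamma$ be a normal subgroup of finite index $n$. Let $\chi$ be a unitary representation of $\Gamma_1$ on a finite-dimensional complex inner product space $V$, let $\alpha_1,\dots,\alpha_n$ be representatives of the right cosets $\Gamma_1\alpha_i$ in $\Gamma$, and let $\psi=U^\chi$ be the induced unitary representation of $\Gamma$ on $V^n$, $$(\psi(\gamma)v)_i=\sum_{j=1}^n\overline\chi(\alpha_i\gamma\alpha_j^{-1})v_j,\qquad \overline\chi=\chi\text{ on }\Gamma_1,\quad \overline\chi=0\text{ off }\Gamma_1 .$$ *The Selberg zeta-function.* Let $G$ be a Kleinian group and $\rho$ a unitary representation of $G$ on a space $W$ of finite dimension $d$. An element of $\mathrm{PSL}(2,\mathbb C)$ is loxodromic if it is conjugate to $\pm\mathrm{diag}(a,a^{-1})$ with $|a|>1$. A loxodromic $T_0\in G$ is primitive if its centralizer in $G$ is a direct product $\langle T_0\rangle\times\langle E\rangle$ with $E$ of finite order $m$. For such $T_0$ and $E$ choose $g\in \mathrm{PSL}(2,\mathbb C)$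 with $gT_0g^{-1}=\pm\mathrm{diag}(a,a^{-1})$, $|a|>1$, and $gEg^{-1}=\pm\mathrm{diag}(\zeta,\zeta^{-1})$, $\zeta$ a primitive $2m$-th root of unity; put $N(T_0)=|a|^2$; and let $\mathfrak t_1,\dots,\mathfrak t_d$ and $\mathfrak t'_1,\dots,\mathfrak t'_d$ be the eigenvalues of $\rho(T_0)$ and $\rho(E)$ along a common eigenbasis of $W$. Let $\mathcal R$ be a maximal reduced system of $G$-conjugacy classes of primitive loxodromic elements, where reduced means that no two different members have representatives with the same centralizer in $G$ and the same attracting fixed point. For $\operatorname{Re}s>1$ put $$Z(s,G,\rho)=\prod_{\{T_0\}\in\mathcal R}\ \prod_{j=1}^{d}\ \prod_{\substack{l,k\ge0\\ \mathfrak t'_j\zeta^{2l}\zeta^{-2k}=1}}\Bigl(1-\mathfrak t_j\,a^{-2k}\,\overline{a^{-2l}}\,N(T_0)^{-s-1}\Bigr).$$ This product is said to converge if the outer product over $\mathcal R$ converges in $\mathbb C$ independently of the order (the limit $0$ not being excluded), and to converge absolutely if $\sum|\mathfrak t_j a^{-2k}\overline{a^{-2l}}N(T_0)^{-s-1}|<\infty$,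 the sum being over all $(T_0,j,l,k)$ that occur in it. **Theorem.** All the choices above ($\mathcal R$, $E$, $g$, $a$, $\zeta$, common eigenbases) can be made for $(\Gamma_1,\chi)$ and for $(\Gamma,\psi)$. For any such choices and every $s$ with $\operatorname{Re}s>1$, $$Z(s,\Gamma_1,\chi)=Z(s,\Gamma,\psi)$$ whenever these products make sense, namely: (i) if the product for $Z(s,\Gamma_1,\chi)$ converges, then so does the product for $Z(s,\Gamma,\psi)$, and the values are equal; (ii) if the product for $Z(s,\Gamma,\psi)$ converges absolutely, then so does the product for $Z(s,\Gamma_1,\chi)$, and the values are equal. -/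

import Mathlib

/-- The group `PSL(2, ℂ)`, with the quotient topology of `SL(2, ℂ)`. -/
abbrev PSL2C : Type := Matrix.ProjectiveSpecialLinearGroup (Fin 2) ℂ

/-- A Kleinian group is a discrete subgroup of `PSL(2, ℂ)`. -/
def IsKleinian (Γ : Subgroup PSL2C) : Prop := DiscreteTopology Γ

/-- The class of the diagonal matrix `diag(a, a⁻¹)` in `PSL(2, ℂ)`. -/
noncomputable def diagPSL (a : ℂˣ) : PSL2C :=
  QuotientGroup.mk (⟨!![(a : ℂ), 0; 0, (a : ℂ)⁻¹], by simp [Matrix.det_fin_two]⟩ :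
    Matrix.SpecialLinearGroup (Fin 2) ℂ)

/-- `T` is loxodromic (hyperbolic elements included). -/
def IsLoxodromic (T : PSL2C) : Prop :=
  ∃ (g : PSL2C) (a : ℂˣ), 1 < ‖(a : ℂ)‖ ∧ g * T * g⁻¹ = diagPSL a

/-- The centralizer of `T` in `Γ` is the internal direct product `⟨T⟩ × ⟨E⟩`, where `⟨E⟩` is
finite. -/
structure CentralizerSplits {Γ : Subgroup PSL2C} (T E : Γ) : Prop where
  finite : IsOfFinOrder E
  commute : Commute T E
  disjoint : Disjoint (Subgroup.zpowers T) (Subgroup.zpowers E)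
  sup_eq : Subgroup.zpowers T ⊔ Subgroup.zpowers E = Subgroup.centralizer {T}

/-- `T` is a primitive loxodromic element of `Γ`. -/
def IsPrimitiveLoxodromic {Γ : Subgroup PSL2C} (T : Γ) : Prop :=
  IsLoxodromic (T : PSL2C) ∧ ∃ E : Γ, CentralizerSplits T E

/-- The `Γ`-conjugacy classes of the loxodromic elements `T` and `T'` have representatives with the
same centralizer in `Γ` and the same direction along their common axis: one and the same `g`
brings both into the form `diag(a, a⁻¹)` with `|a| > 1`. -/
def SameDirectedCentralizer {Γ : Subgroup PSL2C} (T T' : Γ) : Prop :=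
  ∃ γ : Γ, Subgroup.centralizer {T} = Subgroup.centralizer {γ * T' * γ⁻¹} ∧
    ∃ (g : PSL2C) (a a' : ℂˣ), 1 < ‖(a : ℂ)‖ ∧ 1 < ‖(a' : ℂ)‖ ∧
      g * (T : PSL2C) * g⁻¹ = diagPSL a ∧
      g * ((γ * T' * γ⁻¹ : Γ) : PSL2C) * g⁻¹ = diagPSL a'

/-- `R` is a set of representatives of a maximal reduced system of `Γ`-conjugacy classes of
primitive loxodromic elements. -/
structure IsMaximalReduced {Γ : Subgroup PSL2C} (R : Set Γ) : Prop where
  primitive : ∀ T ∈ R, IsPrimitiveLoxodromic T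
  reduced : ∀ T ∈ R, ∀ T' ∈ R, SameDirectedCentralizer T T' → T = T'
  maximal : ∀ T : Γ, IsPrimitiveLoxodromic T → ∃ T' ∈ R, SameDirectedCentralizer T T'

/-- All the choices that enter the Euler product of the Selberg zeta-function of `Γ` and of the
unitary representation `χ`: a maximal reduced system `R` and, for every `T₀ ∈ R`, the generator
`E` of the finite part of its centralizer, the normal forms `diag(a, a⁻¹)` of `T₀` and
`diag(ζ, ζ⁻¹)` of `E` with respect to one frame `g`, and the eigenvalues `t j` of `χ(T₀)` and
`t' j` of `χ(E)`, listed along a common eigenbasis. -/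
structure EulerSystem {V : Type*} [NormedAddCommGroup V] [InnerProductSpace ℂ V]
    (Γ : Subgroup PSL2C) (χ : Γ →* (V ≃ₗᵢ[ℂ] V)) where
  R : Set Γ
  isMaximalReduced : IsMaximalReduced R
  E : R → Γ
  splits : ∀ T : R, CentralizerSplits (T : Γ) (E T)
  g : R → PSL2C
  a : R → ℂˣ
  one_lt_norm_a : ∀ T, 1 < ‖(a T : ℂ)‖
  conj_T : ∀ T : R, g T * ((T : Γ) : PSL2C) * (g T)⁻¹ = diagPSL (a T)
  ζ : R → ℂˣ
  primitiveRoot : ∀ T, IsPrimitiveRoot (ζ T : ℂ) (2 * orderOf (E T))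
  conj_E : ∀ T, g T * (E T : PSL2C) * (g T)⁻¹ = diagPSL (ζ T)
  b : R → Module.Basis (Fin (Module.finrank ℂ V)) ℂ V
  t : R → Fin (Module.finrank ℂ V) → ℂ
  t' : R → Fin (Module.finrank ℂ V) → ℂ
  eigen_T : ∀ (T : R) j, χ (T : Γ) (b T j) = t T j • b T j
  eigen_E : ∀ (T : R) j, χ (E T) (b T j) = t' T j • b T j

namespace EulerSystem

variable {V : Type*} [NormedAddCommGroup V] [InnerProductSpace ℂ V]
  {Γ : Subgroup PSL2C} {χ : Γ →* (V ≃ₗᵢ[ℂ] V)}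

/-- The norm `N(T₀) = |a(T₀)|²`. -/
noncomputable def N (D : EulerSystem Γ χ) (T : D.R) : ℝ := ‖(D.a T : ℂ)‖ ^ 2

/-- `c(T₀, j, l, k) = t'_j ζ^{2l} ζ^{-2k}`. -/
noncomputable def c (D : EulerSystem Γ χ) (T : D.R) (j : Fin (Module.finrank ℂ V)) (l k : ℕ) : ℂ :=
  D.t' T j * (D.ζ T : ℂ) ^ (2 * (l : ℤ)) * (D.ζ T : ℂ) ^ (-2 * (k : ℤ))

/-- The pairs `(l, k)` of natural numbers with `c(T₀, j, l, k) = 1`. -/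
abbrev Pairs (D : EulerSystem Γ χ) (T : D.R) (j : Fin (Module.finrank ℂ V)) : Type :=
  {p : ℕ × ℕ // D.c T j p.1 p.2 = 1}

/-- `t_j a(T₀)^{-2k} conj(a(T₀)^{-2l}) N(T₀)^{-s-1}`. -/
noncomputable def term (D : EulerSystem Γ χ) (s : ℂ) (T : D.R) (j : Fin (Module.finrank ℂ V))
    (l k : ℕ) : ℂ :=
  D.t T j * (D.a T : ℂ) ^ (-2 * (k : ℤ)) * (starRingEnd ℂ) ((D.a T : ℂ) ^ (-2 * (l : ℤ))) *
    (D.N T : ℂ) ^ (-s - 1)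

/-- The factor of `T₀` in the Euler product. -/
noncomputable def localFactor (D : EulerSystem Γ χ) (s : ℂ) (T : D.R) : ℂ :=
  ∏ j, ∏' p : D.Pairs T j, (1 - D.term s T j p.1.1 p.1.2)

/-- The Selberg zeta-function `Z(s, Γ, χ)`. -/
noncomputable def zeta (D : EulerSystem Γ χ) (s : ℂ) : ℂ := ∏' T : D.R, D.localFactor s T

/-- The product over `R` converges in `ℂ`, independently of the order of `R`; the limit `0` is not
excluded. -/
def Converges (D : EulerSystem Γ χ) (s : ℂ) : Prop :=
  Multipliable fun T : D.R => D.localFactor s T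

/-- The product over all `(T₀, j, l, k)` converges absolutely. -/
def ConvergesAbsolutely (D : EulerSystem Γ χ) (s : ℂ) : Prop :=
  Summable fun q : (Σ T : D.R, Σ j : Fin (Module.finrank ℂ V), D.Pairs T j) =>
    ‖D.term s q.1 q.2.1 q.2.2.1.1 q.2.2.1.2‖

end EulerSystem

/-- `α` is a complete set of representatives of the right cosets `Γ₁ α i` of `Γ₁` in `Γ`. -/
def IsRightCosetReps (Γ₁ Γ : Subgroup PSL2C) {n : ℕ} (α : Fin n → Γ) : Prop :=
  ∀ γ : Γ, ∃! i, (γ : PSL2C) * (α i : PSL2C)⁻¹ ∈ Γ₁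

section Induced

variable {V : Type*} [NormedAddCommGroup V] [InnerProductSpace ℂ V]
  {Γ₁ Γ : Subgroup PSL2C} {n : ℕ}

open Classical in
/-- The extension `χ̄` of `χ` by zero. -/
noncomputable def extendZero (χ : Γ₁ →* (V ≃ₗᵢ[ℂ] V)) (x : PSL2C) : V →ₗ[ℂ] V :=
  if h : x ∈ Γ₁ then ((χ ⟨x, h⟩).toLinearEquiv : V →ₗ[ℂ] V) else 0

/-- The block operator `(v_i)_i ↦ (∑ j, χ̄(α i γ (α j)⁻¹) v_j)_i`. -/
noncomputable def inducedLin (χ : Γ₁ →* (V ≃ₗᵢ[ℂ] V)) (α : Fin n → Γ) (γ : Γ) :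
    PiLp 2 (fun _ : Fin n => V) →ₗ[ℂ] PiLp 2 (fun _ : Fin n => V) where
  toFun v := WithLp.toLp 2 fun i =>
    ∑ j, extendZero χ ((α i : PSL2C) * (γ : PSL2C) * (α j : PSL2C)⁻¹) (v j)
  map_add' v w := by
    ext i
    simp [Finset.sum_add_distrib]
  map_smul' r v := by
    ext i
    simp [Finset.smul_sum]

theorem inducedLin_apply (χ : Γ₁ →* (V ≃ₗᵢ[ℂ] V)) (α : Fin n → Γ) (γ : Γ)
    (v : PiLp 2 (fun _ : Fin n => V)) (i : Fin n) :
    inducedLin χ α γ v i =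
      ∑ j, extendZero χ ((α i : PSL2C) * (γ : PSL2C) * (α j : PSL2C)⁻¹) (v j) := rfl

theorem inducedLin_apply_of_mem {α : Fin n → Γ} (hα : IsRightCosetReps Γ₁ Γ α)
    (χ : Γ₁ →* (V ≃ₗᵢ[ℂ] V)) (γ : Γ) (v : PiLp 2 (fun _ : Fin n => V)) (i j : Fin n)
    (h : (α i : PSL2C) * (γ : PSL2C) * (α j : PSL2C)⁻¹ ∈ Γ₁) :
    inducedLin χ α γ v i = χ ⟨_, h⟩ (v j) := by
  rw [inducedLin_apply, Finset.sum_eq_single j]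
  · simp [extendZero, h]
  · intro k _ hk
    have hk' : (α i : PSL2C) * (γ : PSL2C) * (α k : PSL2C)⁻¹ ∉ Γ₁ := fun h' =>
      hk ((hα (α i * γ)).unique (by simpa using h') (by simpa using h))
    simp [extendZero, hk']
  · simp

theorem inducedLin_one {α : Fin n → Γ} (hα : IsRightCosetReps Γ₁ Γ α)
    (χ : Γ₁ →* (V ≃ₗᵢ[ℂ] V)) (v : PiLp 2 (fun _ : Fin n => V)) : inducedLin χ α 1 v = v := by
  ext i
  have h : (α i : PSL2C) * ((1 : Γ) : PSL2C) * (α i : PSL2C)⁻¹ ∈ Γ₁ := by simp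
  rw [inducedLin_apply_of_mem hα χ 1 v i i h]
  have : (⟨_, h⟩ : Γ₁) = 1 := by ext; simp
  rw [this]
  simp

theorem inducedLin_mul {α : Fin n → Γ} (hα : IsRightCosetReps Γ₁ Γ α)
    (χ : Γ₁ →* (V ≃ₗᵢ[ℂ] V)) (γ γ' : Γ) (v : PiLp 2 (fun _ : Fin n => V)) :
    inducedLin χ α (γ * γ') v = inducedLin χ α γ (inducedLin χ α γ' v) := by
  ext i
  obtain ⟨j, hj, -⟩ := hα (α i * γ)
  obtain ⟨k, hk, -⟩ := hα (α j * γ')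
  have hj' : (α i : PSL2C) * (γ : PSL2C) * (α j : PSL2C)⁻¹ ∈ Γ₁ := by simpa using hj
  have hk' : (α j : PSL2C) * (γ' : PSL2C) * (α k : PSL2C)⁻¹ ∈ Γ₁ := by simpa using hk
  have e : (α i : PSL2C) * ((γ * γ' : Γ) : PSL2C) * (α k : PSL2C)⁻¹ =
      ((α i : PSL2C) * (γ : PSL2C) * (α j : PSL2C)⁻¹) *
        ((α j : PSL2C) * (γ' : PSL2C) * (α k : PSL2C)⁻¹) := by
    push_cast
    group
  have hik : (α i : PSL2C) * ((γ * γ' : Γ) : PSL2C) * (α k : PSL2C)⁻¹ ∈ Γ₁ :=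
    e ▸ Γ₁.mul_mem hj' hk'
  rw [inducedLin_apply_of_mem hα χ _ v i k hik, inducedLin_apply_of_mem hα χ γ _ i j hj',
    inducedLin_apply_of_mem hα χ γ' v j k hk']
  have : (⟨_, hik⟩ : Γ₁) = ⟨_, hj'⟩ * ⟨_, hk'⟩ := Subtype.ext e
  rw [this, map_mul]
  rfl

theorem norm_inducedLin {α : Fin n → Γ} (hα : IsRightCosetReps Γ₁ Γ α)
    (χ : Γ₁ →* (V ≃ₗᵢ[ℂ] V)) (γ : Γ) (v : PiLp 2 (fun _ : Fin n => V)) :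
    ‖inducedLin χ α γ v‖ = ‖v‖ := by
  choose σ hσ _ using fun i => hα (α i * γ)
  have hσ' : ∀ i, (α i : PSL2C) * (γ : PSL2C) * (α (σ i) : PSL2C)⁻¹ ∈ Γ₁ := fun i => by
    simpa using hσ i
  have inj : Function.Injective σ := by
    intro i i' h
    have h1 := Γ₁.mul_mem (hσ' i) (Γ₁.inv_mem (hσ' i'))
    rw [← h] at h1
    have h2 : (α i : PSL2C) * (α i' : PSL2C)⁻¹ ∈ Γ₁ := by
      convert h1 using 1
      group
    exact (hα (α i)).unique (by simp) h2
  have bij : Function.Bijective σ := Finite.injective_iff_bijective.mp inj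
  rw [PiLp.norm_eq_of_L2, PiLp.norm_eq_of_L2,
    ← Function.Bijective.sum_comp bij fun i => ‖v i‖ ^ 2]
  congr 1
  refine Finset.sum_congr rfl fun i _ => ?_
  rw [inducedLin_apply_of_mem hα χ γ v i (σ i) (hσ' i), LinearIsometryEquiv.norm_map]

/-- The induced representation `U^χ` of `Γ` on `V^n`. -/
noncomputable def inducedRep {α : Fin n → Γ} (hα : IsRightCosetReps Γ₁ Γ α)
    (χ : Γ₁ →* (V ≃ₗᵢ[ℂ] V)) :
    Γ →* (PiLp 2 (fun _ : Fin n => V) ≃ₗᵢ[ℂ] PiLp 2 (fun _ : Fin n => V)) where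
  toFun γ :=
    { toLinearEquiv := LinearEquiv.ofLinearMap (inducedLin χ α γ) (inducedLin χ α γ⁻¹)
        (by ext1 v; simp [← inducedLin_mul hα, inducedLin_one hα])
        (by ext1 v; simp [← inducedLin_mul hα, inducedLin_one hα])
      norm_map' := fun v => norm_inducedLin hα χ γ v }
  map_one' := by
    ext1 v
    exact inducedLin_one hα χ v
  map_mul' γ γ' := by
    ext1 v
    exact inducedLin_mul hα χ γ γ' v

end Induced

/-! ### The diagonal torus of `PSL(2, ℂ)` -/

/-! A reduced system of `Γ` is a transversal for the oriented axes of loxodromic elements modulo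
`Γ`. Some positive power of each element of `Γ` lies in `Γ₁`, so both groups have the same oriented
axes, and `Γ₁`-classes of axes map to `Γ`-classes. The fibre over `T` is finite and parametrizes the
double cosets `Γ₁ β C(T)` (`exists_fibration`). It suffices to show that the local factor of `T` for
`ψ` is the product of the local factors for `χ` over this fibre (`localFactor_eq_prod`).

Fix `(l, k)`. The condition on `t'` selects one eigenvalue `w` of `ψ(E)`, and the factor of `(l, k)`
is the product of `1 - z u` over the eigenvalues `z` of `ψ(T)` on the `w`-eigenspace of `ψ(E)`,
where `u` is the weight `eulerWeight` of `a²`. For `T₁` in the fibre, `T₁ = β T^e E^i β⁻¹` and `E₁ =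
β E^f β⁻¹` with `e > 0`. Mackey's formula (`finrank_jointEigenspace_inducedRep`) says that the
character `T ↦ z`, `E ↦ w` occurs in `ψ` as often as its restrictions, `T₁ ↦ z^e w^i` and `E₁ ↦
w^f`, occur in `χ`, summed over the fibre. Hence the numbers `z` are the `e`-th roots of the numbers
`t₁ w^{-i}`. Since the weight is multiplicative, `T₁` has weight `u₁ = u^e w^{-i}`, and the product
of `1 - z u` over the `e`-th roots of `t₁ w^{-i}` is `1 - t₁ u₁`.

Grouping a convergent product along finite fibres gives (i). Splitting the groups up again uses
absolute convergence: `|u₁| = |u|^e ≤ |u|` when `Re s > 1`, and the root count bounds the number of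
terms, so the sum for `Γ₁` is dominated by that for `Γ`. -/

theorem PSL2C.mk_eq_mk_iff (A B : Matrix.SpecialLinearGroup (Fin 2) ℂ) :
    (QuotientGroup.mk A : PSL2C) = QuotientGroup.mk B ↔
      ∃ r : ℂ, r ^ 2 = 1 ∧ (B : Matrix (Fin 2) (Fin 2) ℂ) = r • (A : Matrix (Fin 2) (Fin 2) ℂ) := by
  refine QuotientGroup.eq.trans (Matrix.SpecialLinearGroup.mem_center_iff.trans ?_)
  simp only [Fintype.card_fin]
  refine exists_congr fun r => and_congr_right fun _ => ?_
  have key : (A : Matrix (Fin 2) (Fin 2) ℂ) *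
      ((A⁻¹ * B : Matrix.SpecialLinearGroup (Fin 2) ℂ) : Matrix (Fin 2) (Fin 2) ℂ) = B := by
    rw [← Matrix.SpecialLinearGroup.coe_mul, mul_inv_cancel_left]
  have key' : ((A⁻¹ : Matrix.SpecialLinearGroup (Fin 2) ℂ) : Matrix (Fin 2) (Fin 2) ℂ) *
      (A : Matrix (Fin 2) (Fin 2) ℂ) = 1 := by
    rw [← Matrix.SpecialLinearGroup.coe_mul, inv_mul_cancel, Matrix.SpecialLinearGroup.coe_one]
  constructor
  · intro h
    rw [← h, Matrix.scalar_apply, ← Matrix.smul_one_eq_diagonal, Matrix.mul_smul, mul_one] at key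
    exact key.symm
  · intro h
    rw [Matrix.SpecialLinearGroup.coe_mul, h, Matrix.mul_smul, key',
      Matrix.scalar_apply, ← Matrix.smul_one_eq_diagonal]

/-- The diagonal matrix `diag(a, a⁻¹)` in `SL(2, ℂ)`. -/
noncomputable def diagSL (a : ℂˣ) : Matrix.SpecialLinearGroup (Fin 2) ℂ :=
  ⟨!![(a : ℂ), 0; 0, (a : ℂ)⁻¹], by simp [Matrix.det_fin_two]⟩

theorem coe_diagSL (a : ℂˣ) :
    (diagSL a : Matrix (Fin 2) (Fin 2) ℂ) = !![(a : ℂ), 0; 0, (a : ℂ)⁻¹] := rfl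

theorem diagPSL_eq_mk (a : ℂˣ) : diagPSL a = QuotientGroup.mk (diagSL a) := rfl

theorem diagPSL_mul (a b : ℂˣ) : diagPSL (a * b) = diagPSL a * diagPSL b := by
  rw [diagPSL_eq_mk, diagPSL_eq_mk, diagPSL_eq_mk, ← QuotientGroup.mk_mul]
  congr 1
  ext i j
  rw [Matrix.SpecialLinearGroup.coe_mul, coe_diagSL, coe_diagSL, coe_diagSL]
  fin_cases i <;> fin_cases j <;> simp [Matrix.mul_apply, Fin.sum_univ_two, mul_comm]

/-- The map `a ↦ ± diag(a, a⁻¹)` as a homomorphism. -/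
noncomputable def diagHom : ℂˣ →* PSL2C := MonoidHom.mk' diagPSL diagPSL_mul

theorem diagHom_apply (a : ℂˣ) : diagHom a = diagPSL a := rfl

theorem diagPSL_eq_iff (a b : ℂˣ) : diagPSL a = diagPSL b ↔ (a : ℂ) ^ 2 = (b : ℂ) ^ 2 := by
  rw [diagPSL_eq_mk, diagPSL_eq_mk, PSL2C.mk_eq_mk_iff, coe_diagSL, coe_diagSL]
  constructor
  · rintro ⟨r, hr, h⟩
    have h0 := congrFun (congrFun h 0) 0
    simp at h0
    rw [h0, mul_pow, hr, one_mul]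
  · intro h
    refine ⟨b / a, by rw [div_pow, h, div_self (pow_ne_zero _ b.ne_zero)], ?_⟩
    have ha := a.ne_zero
    have hb := b.ne_zero
    ext i j
    fin_cases i <;> fin_cases j <;> simp
    field_simp
    exact h

theorem diagPSL_eq_one_iff (a : ℂˣ) : diagPSL a = 1 ↔ (a : ℂ) ^ 2 = 1 := by
  rw [← map_one diagHom, diagHom_apply, diagPSL_eq_iff]
  simp

/-- The diagonal torus of `PSL(2, ℂ)`. -/
noncomputable def torus : Subgroup PSL2C := diagHom.range

theorem diagPSL_mem_torus (a : ℂˣ) : diagPSL a ∈ torus := ⟨a, rfl⟩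

theorem mem_torus {x : PSL2C} : x ∈ torus ↔ ∃ a, diagPSL a = x := Iff.rfl

theorem torus_commute {x y : PSL2C} (hx : x ∈ torus) (hy : y ∈ torus) : Commute x y := by
  obtain ⟨a, rfl⟩ := hx
  obtain ⟨b, rfl⟩ := hy
  exact (Commute.all a b).map diagHom

/-- Conjugating an expanding diagonal element to an expanding diagonal element requires an element
of the torus. -/
theorem mem_torus_of_conj {h : PSL2C} {a b : ℂˣ} (ha : 1 < ‖(a : ℂ)‖) (hb : 1 < ‖(b : ℂ)‖)
    (hab : h * diagPSL a * h⁻¹ = diagPSL b) : h ∈ torus := by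
  rw [mul_inv_eq_iff_eq_mul] at hab
  induction h using QuotientGroup.induction_on with
  | H M =>
  rw [diagPSL_eq_mk, diagPSL_eq_mk, ← QuotientGroup.mk_mul, ← QuotientGroup.mk_mul,
    PSL2C.mk_eq_mk_iff, Matrix.SpecialLinearGroup.coe_mul, Matrix.SpecialLinearGroup.coe_mul,
    coe_diagSL, coe_diagSL] at hab
  obtain ⟨r, hr, h⟩ := hab
  have hr' : ‖r‖ = 1 := by
    have : ‖r‖ ^ 2 = 1 := by rw [← norm_pow, hr, norm_one]
    nlinarith [norm_nonneg r]
  have h01 := congrFun (congrFun h 0) 1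
  have h10 := congrFun (congrFun h 1) 0
  simp [Matrix.mul_apply, Fin.sum_univ_two] at h01 h10
  have ha' : ‖(a : ℂ)‖⁻¹ < 1 := inv_lt_one_of_one_lt₀ ha
  have hb' : ‖(b : ℂ)‖⁻¹ < 1 := inv_lt_one_of_one_lt₀ hb
  -- The entry equation is `b M₀₁ = r a⁻¹ M₀₁` with `|r| = 1`, while `|a⁻¹| < 1 < |b|`; the entry
  -- `(1, 0)` is treated likewise. This also excludes reversing the axis.
  have m01 : M 0 1 = 0 := by
    by_contra hne
    have hpos : 0 < ‖M 0 1‖ := norm_pos_iff.mpr hne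
    have := congrArg norm h01
    simp only [norm_mul, norm_inv, hr'] at this
    nlinarith
  have m10 : M 1 0 = 0 := by
    by_contra hne
    have hpos : 0 < ‖M 1 0‖ := norm_pos_iff.mpr hne
    have := congrArg norm h10
    simp only [norm_mul, norm_inv, hr'] at this
    nlinarith
  have hdet : M 0 0 * M 1 1 = 1 := by
    have := M.det_coe
    rw [Matrix.det_fin_two] at this
    simpa [m01, m10] using this
  have h0 : M 0 0 ≠ 0 := left_ne_zero_of_mul_eq_one hdet
  refine ⟨Units.mk0 (M 0 0) h0, ?_⟩
  rw [diagHom_apply, diagPSL_eq_mk]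
  congr 1
  ext i j
  rw [coe_diagSL]
  fin_cases i <;> fin_cases j <;> simp [m01, m10]
  exact inv_eq_of_mul_eq_one_right hdet

/-- `g` brings `T` into the form `± diag(a, a⁻¹)` with `|a| > 1`. -/
def Diagonalizes (g T : PSL2C) : Prop :=
  ∃ a : ℂˣ, 1 < ‖(a : ℂ)‖ ∧ g * T * g⁻¹ = diagPSL a

/-- The frame of a loxodromic element is unique up to the torus, so a class of frames modulo the
torus is an oriented axis. -/
theorem Diagonalizes.mul_mem_torus {g g' T : PSL2C} (h : Diagonalizes g T)
    (h' : Diagonalizes g' T) : g * g'⁻¹ ∈ torus := by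
  obtain ⟨a, ha, e⟩ := h
  obtain ⟨a', ha', e'⟩ := h'
  refine mem_torus_of_conj ha' ha ?_
  rw [← e', ← e]
  group

theorem Diagonalizes.of_torus_mul {d g T : PSL2C} (hd : d ∈ torus) (h : Diagonalizes g T) :
    Diagonalizes (d * g) T := by
  obtain ⟨a, ha, e⟩ := h
  refine ⟨a, ha, ?_⟩
  have := (torus_commute hd (diagPSL_mem_torus a)).eq
  rw [← e] at this
  rw [← mul_inv_eq_iff_eq_mul] at this
  rw [← e, ← this]
  group

theorem diagonalizes_conj {g h T : PSL2C} :
    Diagonalizes g (h * T * h⁻¹) ↔ Diagonalizes (g * h) T := by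
  unfold Diagonalizes
  simp only [mul_inv_rev, mul_assoc]

theorem Diagonalizes.pow {g T : PSL2C} (h : Diagonalizes g T) {n : ℕ} (hn : n ≠ 0) :
    Diagonalizes g (T ^ n) := by
  obtain ⟨a, ha, e⟩ := h
  refine ⟨a ^ n, by simpa using one_lt_pow₀ ha hn, ?_⟩
  rw [← conj_pow, e, ← diagHom_apply, ← diagHom_apply, map_pow]

/-- The centralizer depends only on the axis: by `mem_torus_of_conj` an element commuting with `T`
preserves its frame, and conversely the torus is abelian. -/
theorem Diagonalizes.commute_iff {g T c : PSL2C} (h : Diagonalizes g T) :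
    Commute T c ↔ g * c * g⁻¹ ∈ torus := by
  obtain ⟨a, ha, e⟩ := h
  constructor
  · intro hc
    refine mem_torus_of_conj ha ha ?_
    have : c * T * c⁻¹ = T := by rw [← hc.eq, mul_inv_cancel_right]
    rw [← e]
    conv_rhs => rw [← this]
    group
  · intro hc
    have := torus_commute (diagPSL_mem_torus a) hc
    rw [← e] at this
    have h := congrArg (fun x => g⁻¹ * x * g) this.eq
    simpa [commute_iff_eq, mul_assoc] using h

theorem Diagonalizes.mem_centralizer_iff {Γ : Subgroup PSL2C} {g : PSL2C} {T : Γ}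
    (h : Diagonalizes g T) (c : Γ) :
    c ∈ Subgroup.centralizer {T} ↔ g * (c : PSL2C) * g⁻¹ ∈ torus := by
  rw [Subgroup.mem_centralizer_singleton_iff, ← h.commute_iff, commute_iff_eq, eq_comm,
    Subtype.ext_iff]
  simp

/-- Equality of centralizers is automatic once the oriented axes agree, so the relation is just
`Γ`-equivalence of oriented axes. All later arguments about reduced systems use this torus form. -/
theorem sameDirectedCentralizer_iff {Γ : Subgroup PSL2C} {T T' : Γ} {g g' : PSL2C}
    (h : Diagonalizes g T) (h' : Diagonalizes g' T') :
    SameDirectedCentralizer T T' ↔ ∃ γ : Γ, g * γ * g'⁻¹ ∈ torus := by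
  constructor
  · rintro ⟨γ, -, k, a, a', ha, ha', e, e'⟩
    refine ⟨γ, ?_⟩
    have h1 := h.mul_mem_torus ⟨a, ha, e⟩
    have h2 : Diagonalizes k ((γ : PSL2C) * T' * (γ : PSL2C)⁻¹) := ⟨a', ha', by simpa using e'⟩
    have h3 := (diagonalizes_conj.mp h2).mul_mem_torus h'
    have := torus.mul_mem h1 h3
    convert this using 1
    group
  · rintro ⟨γ, hγ⟩
    have h1 : Diagonalizes g ((γ * T' * γ⁻¹ : Γ) : PSL2C) := by
      have : Diagonalizes (g * γ) T' := by
        convert h'.of_torus_mul hγ using 1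
        group
      simpa using diagonalizes_conj.mpr this
    refine ⟨γ, ?_, ?_⟩
    · ext c
      rw [h.mem_centralizer_iff, h1.mem_centralizer_iff]
    · obtain ⟨a, ha, e⟩ := h
      obtain ⟨a', ha', e'⟩ := h1
      exact ⟨g, a, a', ha, ha', e, e'⟩

/-! ### Discreteness -/

/-- The center is closed, being cut out by commutation equations. Hausdorffness is what makes
discrete subgroups closed. -/
instance : T2Space PSL2C := by
  have hfin : IsClosed (Subgroup.center (Matrix.SpecialLinearGroup (Fin 2) ℂ) :
      Set (Matrix.SpecialLinearGroup (Fin 2) ℂ)) := by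
    have : (Subgroup.center (Matrix.SpecialLinearGroup (Fin 2) ℂ) :
      Set (Matrix.SpecialLinearGroup (Fin 2) ℂ)) = ⋂ x, {y | x * y = y * x} := by
      ext y
      simp [Subgroup.mem_center_iff]
    rw [this]
    exact isClosed_iInter fun x => isClosed_eq (by fun_prop) (by fun_prop)
  have := QuotientGroup.instT3Space (Subgroup.center (Matrix.SpecialLinearGroup (Fin 2) ℂ))
    (hN := hfin)
  exact inferInstanceAs (T2Space (Matrix.SpecialLinearGroup (Fin 2) ℂ ⧸ _))

theorem continuous_diagPSL : Continuous diagPSL := by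
  unfold diagPSL
  refine continuous_quotient_mk'.comp ?_
  refine Continuous.subtype_mk ?_ _
  refine continuous_matrix fun i j => ?_
  have h1 : Continuous fun a : ℂˣ => (a : ℂ) := Units.continuous_val
  have h2 : Continuous fun a : ℂˣ => (a : ℂ)⁻¹ := by
    simpa using Units.continuous_coe_inv (M := ℂ)
  fin_cases i <;> fin_cases j <;> simp <;> first | exact h1 | exact h2 | exact continuous_const

/-- Both `a` and `a⁻¹` must be bounded, since `ℂˣ` carries the topology of the closed hyperbola `x y
= 1`. -/
theorem isCompact_diagPSL_image (M : ℝ) :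
    IsCompact (diagPSL '' {a : ℂˣ | ‖(a : ℂ)‖ ≤ M ∧ ‖(a : ℂ)⁻¹‖ ≤ M}) := by
  refine IsCompact.image ?_ continuous_diagPSL
  rw [Units.isEmbedding_embedProduct.isCompact_iff]
  have : Units.embedProduct ℂ '' {a : ℂˣ | ‖(a : ℂ)‖ ≤ M ∧ ‖(a : ℂ)⁻¹‖ ≤ M} =
      {p : ℂ × ℂᵐᵒᵖ | p.1 * p.2.unop = 1} ∩
        (Metric.closedBall 0 M ×ˢ (MulOpposite.unop ⁻¹' Metric.closedBall (0 : ℂ) M)) := by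
    ext ⟨x, y⟩
    simp only [Set.mem_image, Set.mem_ofPred_eq, Units.embedProduct_apply, Prod.mk.injEq,
      Set.mem_inter_iff, Set.mem_prod, mem_closedBall_zero_iff, Set.mem_preimage]
    constructor
    · rintro ⟨a, ⟨h1, h2⟩, rfl, rfl⟩
      simpa using ⟨h1, by simpa using h2⟩
    · rintro ⟨h, h1, h2⟩
      have hx : x ≠ 0 := left_ne_zero_of_mul_eq_one h
      have hy : x⁻¹ = y.unop := inv_eq_of_mul_eq_one_right h
      refine ⟨Units.mk0 x hx, ⟨by simpa using h1, by simpa [hy] using h2⟩, rfl, ?_⟩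
      apply MulOpposite.unop_injective
      simpa using hy
  rw [this]
  refine IsCompact.inter_left ?_ ?_
  · refine (isCompact_closedBall _ _).prod ?_
    have := (isCompact_closedBall (0 : ℂ) M).image (MulOpposite.continuous_op)
    rwa [show (MulOpposite.op : ℂ → ℂᵐᵒᵖ) = MulOpposite.opEquiv from rfl,
      MulOpposite.opEquiv.image_eq_preimage_symm] at this
  · exact isClosed_eq (by fun_prop) continuous_const

theorem IsKleinian.finite_of_isCompact {Γ : Subgroup PSL2C} (hΓ : IsKleinian Γ) {K : Set PSL2C}
    (hK : IsCompact K) : {γ : Γ | (γ : PSL2C) ∈ K}.Finite := by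
  have : DiscreteTopology Γ := hΓ
  have hcl : IsClosed (Γ : Set PSL2C) := Subgroup.isClosed_of_discrete
  exact (hcl.isClosedEmbedding_subtypeVal.isCompact_preimage hK).finite_of_discrete

theorem IsKleinian.mono {Γ Γ₁ : Subgroup PSL2C} (hΓ : IsKleinian Γ) (hle : Γ₁ ≤ Γ) :
    IsKleinian Γ₁ :=
  have : DiscreteTopology (Γ : Set PSL2C) := hΓ
  DiscreteTopology.of_subset (s := (Γ : Set PSL2C)) this hle

/-! ### Stabilizers of oriented axes -/

/-- The elements of `Γ` that `g` brings into diagonal form. -/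
noncomputable def axisSubgroup (Γ : Subgroup PSL2C) (g : PSL2C) : Subgroup Γ :=
  torus.comap ((MulAut.conj g).toMonoidHom.comp Γ.subtype)

theorem mem_axisSubgroup {Γ : Subgroup PSL2C} {g : PSL2C} {c : Γ} :
    c ∈ axisSubgroup Γ g ↔ g * (c : PSL2C) * g⁻¹ ∈ torus := Iff.rfl

theorem Diagonalizes.centralizer_eq {Γ : Subgroup PSL2C} {g : PSL2C} {T : Γ}
    (h : Diagonalizes g T) : Subgroup.centralizer {T} = axisSubgroup Γ g :=
  Subgroup.ext h.mem_centralizer_iff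

/-- The multiplier `a²` of an element that `g` brings into the form `± diag(a, a⁻¹)`. -/
noncomputable def multiplier (Γ : Subgroup PSL2C) (g : PSL2C) : axisSubgroup Γ g →* ℂˣ :=
  -- In `PSL(2, ℂ)` the entry `a` is defined up to sign; squaring makes the choice immaterial.
  MonoidHom.mk' (fun c => (mem_torus.mp (mem_axisSubgroup.mp c.2)).choose ^ 2) (by
    intro c d
    rw [← mul_pow]
    apply Units.ext
    rw [Units.val_pow_eq_pow_val, Units.val_pow_eq_pow_val, ← diagPSL_eq_iff, diagPSL_mul,
      (mem_torus.mp (mem_axisSubgroup.mp c.2)).choose_spec,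
      (mem_torus.mp (mem_axisSubgroup.mp d.2)).choose_spec,
      (mem_torus.mp (mem_axisSubgroup.mp (c * d).2)).choose_spec]
    simp [mul_assoc])

theorem multiplier_eq_iff {Γ : Subgroup PSL2C} {g : PSL2C} (c : axisSubgroup Γ g) (a : ℂˣ) :
    multiplier Γ g c = a ^ 2 ↔ g * (c : PSL2C) * g⁻¹ = diagPSL a := by
  have h := (mem_torus.mp (mem_axisSubgroup.mp c.2)).choose_spec
  rw [← h, diagPSL_eq_iff, Units.ext_iff]
  rfl

theorem multiplier_injective (Γ : Subgroup PSL2C) (g : PSL2C) :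
    Function.Injective (multiplier Γ g) := by
  rw [injective_iff_map_eq_one]
  intro c hc
  rw [← one_pow 2, multiplier_eq_iff, ← diagHom_apply, map_one, mul_inv_eq_one,
    mul_eq_left] at hc
  exact Subtype.ext (Subtype.ext hc)

theorem IsKleinian.finite_multiplier {Γ : Subgroup PSL2C} (hΓ : IsKleinian Γ) (g : PSL2C)
    {M : ℝ} (hM : 0 ≤ M) : {c : axisSubgroup Γ g | ‖(multiplier Γ g c : ℂ)‖ ≤ M ^ 2 ∧
      ‖(multiplier Γ g c : ℂ)⁻¹‖ ≤ M ^ 2}.Finite := by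
  have hK := (isCompact_diagPSL_image M).image
    (f := fun x => g⁻¹ * x * g) (by fun_prop)
  refine Set.Finite.of_finite_image ((hΓ.finite_of_isCompact hK).subset ?_)
    Subtype.val_injective.injOn
  rintro _ ⟨c, ⟨h1, h2⟩, rfl⟩
  obtain ⟨a, ha⟩ := mem_torus.mp (mem_axisSubgroup.mp c.2)
  have hc := (multiplier_eq_iff c a).mpr ha.symm
  rw [hc] at h1 h2
  simp only [Units.val_pow_eq_pow_val, norm_pow, ← inv_pow] at h1 h2
  refine ⟨_, ⟨a, ⟨?_, ?_⟩, rfl⟩, ?_⟩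
  · exact (pow_le_pow_iff_left₀ (norm_nonneg _) hM two_ne_zero).mp h1
  · exact (pow_le_pow_iff_left₀ (norm_nonneg _) hM two_ne_zero).mp h2
  · simp only [ha]
    group

/-- The logarithmic translation length along the axis. -/
noncomputable def axisLength (Γ : Subgroup PSL2C) (g : PSL2C) (c : axisSubgroup Γ g) : ℝ :=
  Real.log ‖(multiplier Γ g c : ℂ)‖

theorem axisLength_mul {Γ : Subgroup PSL2C} {g : PSL2C} (c d : axisSubgroup Γ g) :
    axisLength Γ g (c * d) = axisLength Γ g c + axisLength Γ g d := by
  unfold axisLength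
  rw [map_mul, Units.val_mul, norm_mul, Real.log_mul (by simp) (by simp)]

theorem axisLength_zpow {Γ : Subgroup PSL2C} {g : PSL2C} (c : axisSubgroup Γ g) (p : ℤ) :
    axisLength Γ g (c ^ p) = p * axisLength Γ g c := by
  unfold axisLength
  rw [map_zpow, Units.val_zpow_eq_zpow_val, norm_zpow, Real.log_zpow]

theorem axisLength_pos_iff {Γ : Subgroup PSL2C} {g : PSL2C} (c : axisSubgroup Γ g) :
    0 < axisLength Γ g c ↔ Diagonalizes g (c : Γ) := by
  unfold axisLength
  rw [Real.log_pos_iff (norm_nonneg _)]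
  constructor
  · intro h
    obtain ⟨a, ha⟩ := mem_torus.mp (mem_axisSubgroup.mp c.2)
    refine ⟨a, ?_, ha.symm⟩
    rw [(multiplier_eq_iff c a).mpr ha.symm, Units.val_pow_eq_pow_val, norm_pow] at h
    exact (one_lt_sq_iff₀ (norm_nonneg _)).mp h
  · rintro ⟨a, ha, e⟩
    rw [(multiplier_eq_iff c a).mpr e, Units.val_pow_eq_pow_val, norm_pow]
    exact (one_lt_sq_iff₀ (norm_nonneg _)).mpr ha

/-- Discreteness makes the length function proper: bounded length confines `c` to a compact set. -/
theorem IsKleinian.finite_axisLength {Γ : Subgroup PSL2C} (hΓ : IsKleinian Γ) (g : PSL2C)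
    (M : ℝ) : {c : axisSubgroup Γ g | |axisLength Γ g c| ≤ M}.Finite := by
  -- The half appears because the length is the logarithm of `|a|²`, while the compact set bounds
  -- `|a|`.
  refine (hΓ.finite_multiplier g (Real.exp_nonneg (M / 2))).subset fun c hc => ?_
  have hpos : 0 < ‖(multiplier Γ g c : ℂ)‖ := by simp
  obtain ⟨h1, h2⟩ := abs_le.mp (show |axisLength Γ g c| ≤ M from hc)
  unfold axisLength at h1 h2
  have e : Real.exp (M / 2) ^ 2 = Real.exp M := by
    rw [← Real.exp_nat_mul]
    congr 1
    push_cast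
    ring
  simp only [Set.mem_ofPred_eq, e, norm_inv]
  refine ⟨(Real.log_le_iff_le_exp hpos).mp h2, ?_⟩
  rw [← Real.log_le_iff_le_exp (by positivity), Real.log_inv]
  linarith

/-- Every oriented axis of a loxodromic element of a Kleinian group is the oriented axis of a
primitive one. -/
theorem IsKleinian.exists_primitive {Γ : Subgroup PSL2C} (hΓ : IsKleinian Γ) {g : PSL2C} {T : Γ}
    (hT : Diagonalizes g T) : ∃ T₀ : Γ, Diagonalizes g T₀ ∧ IsPrimitiveLoxodromic T₀ := by
  let ν := axisLength Γ g
  have hTmem : T ∈ axisSubgroup Γ g := by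
    obtain ⟨a, -, e⟩ := hT
    exact mem_axisSubgroup.mpr (e ▸ diagPSL_mem_torus a)
  have hfin : {c : axisSubgroup Γ g | 0 < ν c ∧ ν c ≤ ν ⟨T, hTmem⟩}.Finite :=
    (hΓ.finite_axisLength g (ν ⟨T, hTmem⟩)).subset fun c hc => by
      simpa [abs_of_pos hc.1, ν] using hc.2
  -- `T₀` has the least positive length; it will generate the stabilizer of the axis modulo
  -- rotations.
  obtain ⟨T₀, ⟨h0, h0T⟩, hmin⟩ := Set.exists_min_image _ ν hfin
    ⟨⟨T, hTmem⟩, (axisLength_pos_iff ⟨T, hTmem⟩).mpr hT, le_rfl⟩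
  have hmin' : ∀ c, 0 < ν c → ν T₀ ≤ ν c := fun c hc => by
    by_cases h : ν c ≤ ν ⟨T, hTmem⟩
    · exact hmin c ⟨hc, h⟩
    · exact h0T.trans (not_le.mp h).le
  have hdiag : Diagonalizes g (T₀ : Γ) := (axisLength_pos_iff T₀).mp h0
  -- The rotations about the axis. They are finite in number by discreteness, and cyclic as a finite
  -- group embedded in `ℂˣ`.
  let K : Subgroup (axisSubgroup Γ g) :=
    { carrier := {c | ν c = 0}
      one_mem' := by simp [ν, axisLength]
      mul_mem' := fun {a b} ha hb => by
        simp only [Set.mem_ofPred_eq, ν] at *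
        rw [axisLength_mul, ha, hb, add_zero]
      inv_mem' := fun {a} ha => by
        simp only [Set.mem_ofPred_eq, ν] at *
        rw [← zpow_neg_one, axisLength_zpow, ha, mul_zero] }
  have hKmem : ∀ c, c ∈ K ↔ ν c = 0 := fun c => Iff.rfl
  have hKfin : Finite K := ((hΓ.finite_axisLength g 0).subset fun c hc => by
    have : ν c = 0 := hc
    simp [ν] at this
    simp [this]).to_subtype
  have hcyc : IsCyclic K := isCyclic_of_injective_ringHom
    ((Units.coeHom ℂ).comp ((multiplier Γ g).comp K.subtype))
    (Units.val_injective.comp ((multiplier_injective Γ g).comp Subtype.val_injective))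
  obtain ⟨E, hE⟩ := hcyc.exists_generator
  have hmul : ∀ c : axisSubgroup Γ g, ∃ p : ℤ, T₀ ^ (-p) * c ∈ K := by
    intro c
    -- Division with remainder: the remaining length lies in `[0, ν T₀)`, so it vanishes by
    -- minimality.
    refine ⟨⌊ν c / ν T₀⌋, ?_⟩
    rw [hKmem]
    simp only [ν] at *
    rw [axisLength_mul, axisLength_zpow]
    set x := axisLength Γ g c with hx
    set y := axisLength Γ g T₀ with hy
    have h1 := Int.floor_le (x / y)
    have h2 := Int.lt_floor_add_one (x / y)
    rw [le_div_iff₀ h0] at h1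
    rw [div_lt_iff₀ h0] at h2
    by_contra hne
    have hpos : 0 < ((-⌊x / y⌋ : ℤ) : ℝ) * y + x := by
      refine lt_of_le_of_ne ?_ (Ne.symm hne)
      push_cast
      linarith
    have := hmin' (T₀ ^ (-⌊x / y⌋) * c) (by rw [axisLength_mul, axisLength_zpow]; exact hpos)
    rw [axisLength_mul, axisLength_zpow, ← hx, ← hy] at this
    push_cast at this
    linarith
  have hcent := hdiag.centralizer_eq
  refine ⟨T₀, hdiag, ⟨g, hdiag⟩, (E : axisSubgroup Γ g), ?_, ?_, ?_, ?_⟩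
  · have : IsOfFinOrder E := isOfFinOrder_of_finite E
    exact ((axisSubgroup Γ g).subtype.isOfFinOrder (K.subtype.isOfFinOrder this))
  · have := hcent.ge (E : axisSubgroup Γ g).2
    rw [Subgroup.mem_centralizer_singleton_iff] at this
    exact this.symm
  · rw [Subgroup.disjoint_def]
    intro x hx hx'
    obtain ⟨p, rfl⟩ := Subgroup.mem_zpowers_iff.mp hx
    obtain ⟨q, hq⟩ := Subgroup.mem_zpowers_iff.mp hx'
    have h1 : ((E : axisSubgroup Γ g)) ^ q = T₀ ^ p := Subtype.ext (by simpa using hq)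
    have h2 : ν (T₀ ^ p) = 0 := by
      rw [← h1, ← hKmem]
      exact K.zpow_mem E.2 q
    simp only [ν] at h2 h0
    rw [axisLength_zpow] at h2
    have : p = 0 := by
      rcases mul_eq_zero.mp h2 with h | h
      · exact_mod_cast h
      · exact absurd h h0.ne'
    rw [this, zpow_zero]
  · rw [hcent]
    apply le_antisymm
    · rw [sup_le_iff, Subgroup.zpowers_le, Subgroup.zpowers_le]
      exact ⟨T₀.2, (E : axisSubgroup Γ g).2⟩
    · intro c hc
      obtain ⟨p, hp⟩ := hmul ⟨c, hc⟩
      obtain ⟨q, hq⟩ := Subgroup.mem_zpowers_iff.mp (hE ⟨_, hp⟩)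
      have h1 : c = (T₀ : Γ) ^ p * ((E : axisSubgroup Γ g) : Γ) ^ q := by
        have := congrArg (fun x : K => ((x : axisSubgroup Γ g) : Γ)) hq
        simp only [SubgroupClass.coe_zpow, Subgroup.coe_mul] at this
        rw [this]
        group
      rw [h1]
      exact mul_mem (Subgroup.mem_sup_left (Subgroup.zpow_mem_zpowers _ _))
        (Subgroup.mem_sup_right (Subgroup.zpow_mem_zpowers _ _))

theorem CentralizerSplits.mem_centralizer_iff {Γ : Subgroup PSL2C} {T E : Γ}
    (h : CentralizerSplits T E) (c : Γ) :
    c ∈ Subgroup.centralizer {T} ↔ ∃ p q : ℤ, c = T ^ p * E ^ q := by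
  rw [← h.sup_eq]
  constructor
  · intro hc
    have key : (zpowersHom Γ T).range ⊔ (zpowersHom Γ E).range =
        (MonoidHom.noncommCoprod (zpowersHom Γ T) (zpowersHom Γ E) (fun x y => by
          simp only [zpowersHom_apply]
          exact (h.commute.zpow_zpow _ _))).range := by
      rw [MonoidHom.noncommCoprod_range]
    have : c ∈ (zpowersHom Γ T).range ⊔ (zpowersHom Γ E).range := hc
    rw [key] at this
    obtain ⟨⟨p, q⟩, rfl⟩ := this
    exact ⟨p.toAdd, q.toAdd, by simp⟩
  · rintro ⟨p, q, rfl⟩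
    exact mul_mem (Subgroup.mem_sup_left (Subgroup.zpow_mem_zpowers _ _))
      (Subgroup.mem_sup_right (Subgroup.zpow_mem_zpowers _ _))

/-! ### Existence of Euler systems -/

/-- The orthogonal complement of an invariant subspace is invariant, because in finite dimension the
subspace is mapped onto itself. -/
theorem LinearIsometryEquiv.isSemisimple {W : Type*} [NormedAddCommGroup W]
    [InnerProductSpace ℂ W] [FiniteDimensional ℂ W] (A : W ≃ₗᵢ[ℂ] W) :
    Module.End.IsSemisimple (A.toLinearEquiv : W →ₗ[ℂ] W) := by
  rw [Module.End.isSemisimple_iff]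
  intro p hp
  have hmap : p.map (A.toLinearEquiv : W →ₗ[ℂ] W) = p := by
    refine Submodule.eq_of_le_of_finrank_eq ?_ (LinearEquiv.finrank_map_eq A.toLinearEquiv p)
    rw [Submodule.map_le_iff_le_comap]
    exact hp
  refine ⟨pᗮ, ?_, Submodule.isCompl_orthogonal p⟩
  intro x hx
  rw [Submodule.mem_comap, Submodule.mem_orthogonal]
  intro y hy
  rw [← hmap] at hy
  obtain ⟨y', hy', rfl⟩ := hy
  exact (A.inner_map_map y' x).trans ((Submodule.mem_orthogonal p x).mp hx y' hy')

/-- Joint generalized eigenspaces of commuting operators over `ℂ` span, and semisimplicity makes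
them genuine eigenspaces; a basis is then extracted from the joint eigenvectors. -/
theorem exists_common_eigenbasis {W : Type*} [NormedAddCommGroup W]
    [InnerProductSpace ℂ W] [FiniteDimensional ℂ W] {A B : W ≃ₗᵢ[ℂ] W} (h : Commute A B) :
    ∃ (b : Module.Basis (Fin (Module.finrank ℂ W)) ℂ W) (t t' : Fin (Module.finrank ℂ W) → ℂ),
      (∀ j, A (b j) = t j • b j) ∧ ∀ j, B (b j) = t' j • b j := by
  let f : Bool → Module.End ℂ W := fun i => cond i (A.toLinearEquiv : W →ₗ[ℂ] W)
    (B.toLinearEquiv : W →ₗ[ℂ] W)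
  have hAB : Commute (f true) (f false) := by
    ext1 v
    exact DFunLike.congr_fun h.eq v
  have hcomm : ∀ i j, Commute (f i) (f j) := by
    rintro (_ | _) (_ | _)
    exacts [Commute.refl _, hAB.symm, hAB, Commute.refl _]
  have hss : ∀ i, (f i).IsSemisimple := by
    rintro (_ | _)
    exacts [B.isSemisimple, A.isSemisimple]
  have htop := Module.End.iSup_iInf_maxGenEigenspace_eq_top_of_forall_mapsTo f
    (fun i j φ => Module.End.mapsTo_maxGenEigenspace_of_comm (hcomm j i) φ)
    (fun i => Module.End.iSup_maxGenEigenspace_eq_top (f i))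
  let S : Set W := {v | ∃ z w : ℂ, A v = z • v ∧ B v = w • v}
  have hS : ⊤ ≤ Submodule.span ℂ S := by
    rw [← htop]
    refine iSup_le fun μ v hv => Submodule.subset_span ⟨μ true, μ false, ?_, ?_⟩
    · have := (Submodule.mem_iInf _).mp hv true
      rw [(hss true).isFinitelySemisimple.maxGenEigenspace_eq_eigenspace,
        Module.End.mem_eigenspace_iff] at this
      exact this
    · have := (Submodule.mem_iInf _).mp hv false
      rw [(hss false).isFinitelySemisimple.maxGenEigenspace_eq_eigenspace,
        Module.End.mem_eigenspace_iff] at this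
      exact this
  let b := (Module.Basis.ofSpan hS).reindex
    ((Module.Basis.ofSpan hS).indexEquiv (Module.finBasis ℂ W))
  have hb : ∀ j, b j ∈ S := fun j => by
    rw [Module.Basis.reindex_apply]
    exact Module.Basis.ofSpan_subset hS ⟨_, rfl⟩
  choose t t' h1 h2 using hb
  exact ⟨b, t, t', h1, h2⟩

theorem orderOf_diagPSL (a : ℂˣ) : orderOf (diagPSL a) = orderOf ((a : ℂ) ^ 2) := by
  rw [orderOf_eq_orderOf_iff]
  intro k
  rw [← diagHom_apply, ← map_pow, diagHom_apply, diagPSL_eq_one_iff, Units.val_pow_eq_pow_val,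
    pow_right_comm]

/-- An element of order `m` of the torus has the form `± diag(ζ, ζ⁻¹)` with `ζ` a primitive `2m`-th
root of unity. -/
theorem exists_primitiveRoot_of_mem_torus {x : PSL2C} (hx : x ∈ torus) (hfin : IsOfFinOrder x) :
    ∃ ζ : ℂˣ, IsPrimitiveRoot (ζ : ℂ) (2 * orderOf x) ∧ x = diagPSL ζ := by
  obtain ⟨a, rfl⟩ := mem_torus.mp hx
  have hm : orderOf ((a : ℂ) ^ 2) ≠ 0 := by
    rw [← orderOf_diagPSL]
    exact hfin.orderOf_pos.ne'
  rw [orderOf_diagPSL]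
  have hfa : IsOfFinOrder (a : ℂ) := by
    rw [← orderOf_pos_iff]
    by_contra h0
    have h0 : orderOf (a : ℂ) = 0 := by omega
    rw [orderOf_pow' _ two_ne_zero, h0] at hm
    simp at hm
  have hr := hfa.orderOf_pos
  -- Both `a` and `-a` represent `x`. If `a` has odd order `m`, then `-a` has order `2m`; if its
  -- order is even, it is already `2m`.
  rcases Nat.even_or_odd (orderOf (a : ℂ)) with he | ho
  · refine ⟨a, ?_, rfl⟩
    have : 2 * orderOf ((a : ℂ) ^ 2) = orderOf (a : ℂ) := by
      rw [orderOf_pow' _ two_ne_zero, Nat.gcd_eq_right he.two_dvd, Nat.mul_div_cancel' he.two_dvd]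
    rw [this]
    exact IsPrimitiveRoot.orderOf _
  · refine ⟨-a, ?_, by rw [diagPSL_eq_iff]; simp⟩
    have hcop : Nat.Coprime (orderOf (a : ℂ)) 2 := ho.coprime_two_right
    have h2 : orderOf ((a : ℂ) ^ 2) = orderOf (a : ℂ) := hcop.orderOf_pow
    have hneg : orderOf (-1 : ℂ) = 2 := by
      rw [orderOf_neg_one, ringChar.eq_zero]; simp
    have : orderOf ((-a : ℂˣ) : ℂ) = 2 * orderOf ((a : ℂ) ^ 2) := by
      rw [h2, Units.val_neg, neg_eq_neg_one_mul,
        (Commute.all (-1 : ℂ) a).orderOf_mul_eq_mul_orderOf_of_coprime (by rw [hneg]; exact hcop.symm),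
        hneg]
    rw [← this]
    exact IsPrimitiveRoot.orderOf _

theorem sameDirectedCentralizer_equivalence (Γ : Subgroup PSL2C) :
    Equivalence fun T T' : {T : Γ // IsLoxodromic (T : PSL2C)} =>
      SameDirectedCentralizer (T : Γ) (T' : Γ) where
  refl T := by
    obtain ⟨g, hg⟩ := T.2
    exact (sameDirectedCentralizer_iff hg hg).mpr ⟨1, by simp [torus.one_mem]⟩
  symm {T T'} h := by
    obtain ⟨g, hg⟩ := T.2
    obtain ⟨g', hg'⟩ := T'.2
    obtain ⟨γ, hγ⟩ := (sameDirectedCentralizer_iff hg hg').mp h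
    refine (sameDirectedCentralizer_iff hg' hg).mpr ⟨γ⁻¹, ?_⟩
    convert torus.inv_mem hγ using 1
    simp [mul_assoc]
  trans {T T' T''} h h' := by
    obtain ⟨g, hg⟩ := T.2
    obtain ⟨g', hg'⟩ := T'.2
    obtain ⟨g'', hg''⟩ := T''.2
    obtain ⟨γ, hγ⟩ := (sameDirectedCentralizer_iff hg hg').mp h
    obtain ⟨γ', hγ'⟩ := (sameDirectedCentralizer_iff hg' hg'').mp h'
    refine (sameDirectedCentralizer_iff hg hg'').mpr ⟨γ * γ', ?_⟩
    convert torus.mul_mem hγ hγ' using 1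
    simp [mul_assoc]

theorem exists_isMaximalReduced (Γ : Subgroup PSL2C) : ∃ R : Set Γ, IsMaximalReduced R := by
  let S : Setoid {T : Γ // IsPrimitiveLoxodromic T} :=
    ⟨fun T T' => SameDirectedCentralizer (T : Γ) (T' : Γ),
      (sameDirectedCentralizer_equivalence Γ).comap
        fun T : {T : Γ // IsPrimitiveLoxodromic T} => ⟨T.1, T.2.1⟩⟩
  refine ⟨Set.range fun q : Quotient S => (q.out : Γ), ?_, ?_, ?_⟩
  · rintro _ ⟨q, rfl⟩
    exact q.out.2
  · rintro _ ⟨q, rfl⟩ _ ⟨q', rfl⟩ h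
    have : q = q' := by
      rw [← q.out_eq, ← q'.out_eq]
      exact Quotient.sound h
    rw [this]
  · intro T hT
    exact ⟨_, ⟨(Quotient.mk S ⟨T, hT⟩), rfl⟩, Setoid.symm (Quotient.mk_out (s := S) ⟨T, hT⟩)⟩

theorem EulerSystem.nonempty {W : Type*} [NormedAddCommGroup W] [InnerProductSpace ℂ W]
    [FiniteDimensional ℂ W] (Γ : Subgroup PSL2C) (ρ : Γ →* (W ≃ₗᵢ[ℂ] W)) :
    Nonempty (EulerSystem Γ ρ) := by
  obtain ⟨R, hR⟩ := exists_isMaximalReduced Γ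
  choose E hE using fun T : R => (hR.primitive T T.2).2
  choose g a ha hga using fun T : R => (hR.primitive T T.2).1
  have hζ : ∀ T : R, ∃ ζ : ℂˣ, IsPrimitiveRoot (ζ : ℂ) (2 * orderOf (E T)) ∧
      g T * (E T : PSL2C) * (g T)⁻¹ = diagPSL ζ := by
    intro T
    -- `E` commutes with `T`, so the frame of `T` diagonalizes `E` as well.
    have hmem : g T * (E T : PSL2C) * (g T)⁻¹ ∈ torus := by
      rw [← Diagonalizes.commute_iff ⟨a T, ha T, hga T⟩]
      exact (hE T).commute.map Γ.subtype
    have hord : orderOf (g T * (E T : PSL2C) * (g T)⁻¹) = orderOf (E T) :=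
      (MulEquiv.orderOf_eq (MulAut.conj (g T)) (E T : PSL2C)).trans (Subgroup.orderOf_coe _)
    have := exists_primitiveRoot_of_mem_torus hmem (by
      rw [← orderOf_pos_iff, hord]
      exact (hE T).finite.orderOf_pos)
    rwa [hord] at this
  choose ζ hζ1 hζ2 using hζ
  choose b t t' h1 h2 using fun T : R => exists_common_eigenbasis ((hE T).commute.map ρ)
  exact ⟨⟨R, hR, E, hE, g, a, ha, hga, ζ, hζ1, hζ2, b, t, t', h1, h2⟩⟩

/-! ### Joint eigenspaces -/

/-- The joint eigenspace of `A` and `B` for the eigenvalues `z` and `w`. -/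
def jointEigenspace {W : Type*} [AddCommGroup W] [Module ℂ W] (A B : W →ₗ[ℂ] W) (z w : ℂ) :
    Submodule ℂ W := Module.End.eigenspace A z ⊓ Module.End.eigenspace B w

theorem mem_jointEigenspace {W : Type*} [AddCommGroup W] [Module ℂ W] {A B : W →ₗ[ℂ] W}
    {z w : ℂ} {v : W} : v ∈ jointEigenspace A B z w ↔ A v = z • v ∧ B v = w • v := by
  rw [jointEigenspace, Submodule.mem_inf, Module.End.mem_eigenspace_iff,
    Module.End.mem_eigenspace_iff]

/-- Expresses the multiplicities of eigenvalue pairs without reference to the chosen eigenbasis, so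
that they can be compared between `χ` and `ψ`. -/
theorem finrank_jointEigenspace {W ι : Type*} [AddCommGroup W] [Module ℂ W] [Fintype ι]
    {A B : W →ₗ[ℂ] W} (b : Module.Basis ι ℂ W) {t t' : ι → ℂ} (hA : ∀ j, A (b j) = t j • b j)
    (hB : ∀ j, B (b j) = t' j • b j) (z w : ℂ) :
    Module.finrank ℂ (jointEigenspace A B z w) =
      (Finset.univ.filter fun j => t j = z ∧ t' j = w).card := by
  classical
  have hcoord : ∀ (C : W →ₗ[ℂ] W) (r : ι → ℂ), (∀ j, C (b j) = r j • b j) → ∀ v j,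
      b.repr (C v) j = r j * b.repr v j := by
    intro C r hC v j
    have : (b.coord j).comp C = r j • b.coord j := by
      refine b.ext fun k => ?_
      by_cases hk : k = j
      · subst hk
        simp [hC]
      · simp [hC, hk]
    exact LinearMap.congr_fun this v
  have hspan : jointEigenspace A B z w =
      Submodule.span ℂ (Set.range fun j : {j // t j = z ∧ t' j = w} => b j) := by
    apply le_antisymm
    · intro v hv
      rw [mem_jointEigenspace] at hv
      rw [← b.sum_repr v]
      refine Submodule.sum_mem _ fun j _ => ?_
      by_cases hj : b.repr v j = 0
      · rw [hj, zero_smul]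
        exact Submodule.zero_mem _
      · refine Submodule.smul_mem _ _ (Submodule.subset_span ⟨⟨j, ?_, ?_⟩, rfl⟩)
        · have := hcoord A t hA v j
          rw [hv.1, map_smul, Finsupp.smul_apply, smul_eq_mul] at this
          exact (mul_right_cancel₀ hj this).symm
        · have := hcoord B t' hB v j
          rw [hv.2, map_smul, Finsupp.smul_apply, smul_eq_mul] at this
          exact (mul_right_cancel₀ hj this).symm
    · rw [Submodule.span_le]
      rintro _ ⟨⟨j, h1, h2⟩, rfl⟩
      rw [SetLike.mem_coe, mem_jointEigenspace]
      exact ⟨(hA j).trans (congrArg (· • b j) h1), (hB j).trans (congrArg (· • b j) h2)⟩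
  rw [hspan]
  refine (finrank_span_eq_card (b.linearIndependent.comp _ Subtype.val_injective)).trans ?_
  rw [Fintype.card_subtype]

theorem LinearIsometryEquiv.zpow_apply_of_eigen {W : Type*} [NormedAddCommGroup W]
    [InnerProductSpace ℂ W] (A : W ≃ₗᵢ[ℂ] W) {z : ℂ} (hz : z ≠ 0) {v : W} (h : A v = z • v)
    (p : ℤ) : (A ^ p) v = z ^ p • v := by
  have hinv : A⁻¹ v = z⁻¹ • v := by
    apply A.injective
    rw [map_smul, h, smul_smul, inv_mul_cancel₀ hz, one_smul]
    exact A.apply_symm_apply v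
  induction p with
  | zero => simp
  | succ p ih => rw [zpow_add_one, LinearIsometryEquiv.coe_mul, Function.comp_apply, h, map_smul,
      ih, smul_smul, zpow_add_one₀ hz, mul_comm]
  | pred p ih => rw [zpow_sub_one, LinearIsometryEquiv.coe_mul, Function.comp_apply, hinv,
      map_smul, ih, smul_smul, zpow_sub_one₀ hz, mul_comm]

/-! ### Joint eigenspaces of the induced representation -/

section Induced

variable {V : Type*} [NormedAddCommGroup V] [InnerProductSpace ℂ V]
  {Γ₁ Γ : Subgroup PSL2C} {n : ℕ}

/-- The value at `γ` of the `Γ₁`-equivariant function on `Γ` that takes the value `v i` at `α i`. -/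
noncomputable def equivariantEval (χ : Γ₁ →* (V ≃ₗᵢ[ℂ] V)) (α : Fin n → Γ) (γ : PSL2C) :
    PiLp 2 (fun _ : Fin n => V) →ₗ[ℂ] V where
  toFun v := ∑ j, extendZero χ (γ * (α j : PSL2C)⁻¹) (v j)
  map_add' v w := by simp [Finset.sum_add_distrib]
  map_smul' r v := by simp [Finset.smul_sum]

variable {α : Fin n → Γ}

theorem inducedRep_apply_eq (hα : IsRightCosetReps Γ₁ Γ α) (χ : Γ₁ →* (V ≃ₗᵢ[ℂ] V)) (γ : Γ)
    (v : PiLp 2 (fun _ : Fin n => V)) (i : Fin n) :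
    inducedRep hα χ γ v i = equivariantEval χ α ((α i : PSL2C) * γ) v := rfl

theorem equivariantEval_of_mem (hα : IsRightCosetReps Γ₁ Γ α) (χ : Γ₁ →* (V ≃ₗᵢ[ℂ] V)) (γ : Γ)
    (v : PiLp 2 (fun _ : Fin n => V)) (j : Fin n) (h : (γ : PSL2C) * (α j : PSL2C)⁻¹ ∈ Γ₁) :
    equivariantEval χ α γ v = χ ⟨_, h⟩ (v j) := by
  change ∑ k, extendZero χ ((γ : PSL2C) * (α k : PSL2C)⁻¹) (v k) = _
  rw [Finset.sum_eq_single j]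
  · simp [extendZero, h]
  · intro k _ hk
    have hk' : (γ : PSL2C) * (α k : PSL2C)⁻¹ ∉ Γ₁ := fun h' => hk ((hα γ).unique h' h)
    simp [extendZero, hk']
  · simp

theorem equivariantEval_coset_rep (hα : IsRightCosetReps Γ₁ Γ α) (χ : Γ₁ →* (V ≃ₗᵢ[ℂ] V))
    (v : PiLp 2 (fun _ : Fin n => V)) (i : Fin n) : equivariantEval χ α (α i) v = v i := by
  have h : (α i : PSL2C) * (α i : PSL2C)⁻¹ ∈ Γ₁ := by simp
  rw [equivariantEval_of_mem hα χ (α i) v i h]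
  have : (⟨_, h⟩ : Γ₁) = 1 := by ext; simp
  rw [this]
  simp

theorem equivariantEval_mul_left (hle : Γ₁ ≤ Γ) (hα : IsRightCosetReps Γ₁ Γ α)
    (χ : Γ₁ →* (V ≃ₗᵢ[ℂ] V)) (δ : Γ₁) (γ : Γ) (v : PiLp 2 (fun _ : Fin n => V)) :
    equivariantEval χ α ((δ : PSL2C) * γ) v = χ δ (equivariantEval χ α γ v) := by
  obtain ⟨j, hj, -⟩ := hα γ
  have hj' : (((⟨δ, hle δ.2⟩ : Γ) * γ : Γ) : PSL2C) * (α j : PSL2C)⁻¹ ∈ Γ₁ := by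
    simpa [mul_assoc] using Γ₁.mul_mem δ.2 hj
  rw [equivariantEval_of_mem hα χ γ v j hj]
  refine (equivariantEval_of_mem hα χ ((⟨δ, hle δ.2⟩ : Γ) * γ) v j hj').trans ?_
  have : (⟨_, hj'⟩ : Γ₁) = δ * ⟨_, hj⟩ := by ext; simp [mul_assoc]
  rw [this, map_mul]
  rfl

/-- With `V^n` viewed as the space of functions satisfying `f (δ γ) = χ(δ) f(γ)`, the induced
representation is right translation. -/
theorem equivariantEval_inducedRep (hle : Γ₁ ≤ Γ) (hα : IsRightCosetReps Γ₁ Γ α)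
    (χ : Γ₁ →* (V ≃ₗᵢ[ℂ] V)) (γ c : Γ) (v : PiLp 2 (fun _ : Fin n => V)) :
    equivariantEval χ α γ (inducedRep hα χ c v) = equivariantEval χ α ((γ : PSL2C) * c) v := by
  obtain ⟨j, hj, -⟩ := hα γ
  rw [equivariantEval_of_mem hα χ γ _ j hj, inducedRep_apply_eq]
  have := equivariantEval_mul_left hle hα χ ⟨_, hj⟩ (α j * c) v
  rw [Subgroup.coe_mul] at this
  rw [← this]
  congr 2
  simp [mul_assoc]

/-- The multiplicity of a character `θ` of the centralizer of `T` in the induced representation: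
the sum, over the double cosets `Γ₁ (β x) C(T)`, of the multiplicities in `χ` of the restrictions
of `θ`. Here `θ` maps `T ↦ z` and `E ↦ w`. -/
theorem finrank_jointEigenspace_inducedRep [FiniteDimensional ℂ V] (hle : Γ₁ ≤ Γ)
    (hα : IsRightCosetReps Γ₁ Γ α) (χ : Γ₁ →* (V ≃ₗᵢ[ℂ] V)) {T E : Γ}
    (hTE : CentralizerSplits T E) (hT : ∀ p : ℤ, T ^ p = 1 → p = 0) {z w : ℂ} (hz : z ≠ 0)
    (hw : w ^ orderOf E = 1) {ι : Type*} [Fintype ι] (β : ι → Γ) (S F : ι → Γ₁) (e i f : ι → ℤ)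
    (hS : ∀ x, (S x : PSL2C) * β x = β x * (T ^ e x * E ^ i x : Γ))
    (hF : ∀ x, (F x : PSL2C) * β x = β x * (E ^ f x : Γ))
    (hcent : ∀ x (δ : Γ₁) (c : Γ), c ∈ Subgroup.centralizer {T} → (δ : PSL2C) * β x = β x * c →
      ∃ p q : ℤ, δ = S x ^ p * F x ^ q)
    (hcover : ∀ γ : Γ, ∃ x, ∃ δ : Γ₁, ∃ c ∈ Subgroup.centralizer {T},
      (γ : PSL2C) = δ * β x * (c : Γ))
    (hdisj : ∀ x x' (δ : Γ₁) (c : Γ), c ∈ Subgroup.centralizer {T} →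
      (β x' : PSL2C) = δ * β x * c → x = x') :
    Module.finrank ℂ (jointEigenspace
        ((inducedRep hα χ T).toLinearEquiv : PiLp 2 (fun _ : Fin n => V) →ₗ[ℂ] _)
        ((inducedRep hα χ E).toLinearEquiv : PiLp 2 (fun _ : Fin n => V) →ₗ[ℂ] _) z w) =
      ∑ x, Module.finrank ℂ (jointEigenspace ((χ (S x)).toLinearEquiv : V →ₗ[ℂ] V)
        ((χ (F x)).toLinearEquiv : V →ₗ[ℂ] V) (z ^ e x * w ^ i x) (w ^ f x)) := by
  classical
  have hEpos := hTE.finite.orderOf_pos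
  have hw0 : w ≠ 0 := by
    rintro rfl
    rw [zero_pow hEpos.ne'] at hw
    exact zero_ne_one hw
  -- the values of the character are well defined
  have hchar : ∀ p q p' q' : ℤ, T ^ p * E ^ q = T ^ p' * E ^ q' → p = p' ∧ w ^ q = w ^ q' := by
    intro p q p' q' h
    have h1 : T ^ (p - p') = E ^ (q' - q) := by
      rw [zpow_sub E, sub_eq_neg_add, zpow_add, zpow_neg, inv_mul_eq_iff_eq_mul, ← mul_assoc,
        ← h, mul_inv_cancel_right]
    have h2 : T ^ (p - p') = 1 :=
      (Subgroup.disjoint_def.mp hTE.disjoint) (Subgroup.zpow_mem_zpowers _ _)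
        (h1 ▸ Subgroup.zpow_mem_zpowers _ _)
    have h3 : E ^ (q' - q) = 1 := h1 ▸ h2
    refine ⟨by have := hT _ h2; omega, ?_⟩
    obtain ⟨k, hk⟩ := orderOf_dvd_iff_zpow_eq_one.mpr h3
    have : q' = q + orderOf E * k := by omega
    rw [this, zpow_add₀ hw0, zpow_mul, zpow_natCast, hw, one_zpow, mul_one]
  have hψ : ∀ v : PiLp 2 (fun _ : Fin n => V), inducedRep hα χ T v = z • v →
      inducedRep hα χ E v = w • v → ∀ p q : ℤ,
      inducedRep hα χ (T ^ p * E ^ q) v = (z ^ p * w ^ q) • v := by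
    intro v h1 h2 p q
    rw [map_mul, map_zpow, map_zpow, LinearIsometryEquiv.coe_mul, Function.comp_apply,
      LinearIsometryEquiv.zpow_apply_of_eigen _ hw0 h2, map_smul,
      LinearIsometryEquiv.zpow_apply_of_eigen _ hz h1, smul_smul, mul_comm]
  -- A joint eigenvector is a function with `f (γ c) = θ(c) f(γ)` for `c ∈ C(T)`. It is determined
  -- on `Γ₁ (β x) C(T)` by its value at `β x`, and `L` records these values; the relations `hS` and
  -- `hF` make them joint eigenvectors of `χ (S x)` and `χ (F x)`.
  let L : jointEigenspace
        ((inducedRep hα χ T).toLinearEquiv : PiLp 2 (fun _ : Fin n => V) →ₗ[ℂ] _)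
        ((inducedRep hα χ E).toLinearEquiv : PiLp 2 (fun _ : Fin n => V) →ₗ[ℂ] _) z w →ₗ[ℂ]
      ∀ x, jointEigenspace ((χ (S x)).toLinearEquiv : V →ₗ[ℂ] V)
        ((χ (F x)).toLinearEquiv : V →ₗ[ℂ] V) (z ^ e x * w ^ i x) (w ^ f x) :=
    LinearMap.pi fun x => LinearMap.codRestrict _
      ((equivariantEval χ α (β x)).comp (Submodule.subtype _)) (by
        rintro ⟨v, hv⟩
        rw [mem_jointEigenspace] at hv ⊢
        constructor
        · change χ (S x) (equivariantEval χ α (β x) v) = _ • equivariantEval χ α (β x) v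
          rw [← equivariantEval_mul_left hle hα, hS, ← equivariantEval_inducedRep hle hα,
            hψ v hv.1 hv.2, map_smul]
        · change χ (F x) (equivariantEval χ α (β x) v) = _ • equivariantEval χ α (β x) v
          have := hψ v hv.1 hv.2 0 (f x)
          rw [zpow_zero, one_mul, zpow_zero, one_mul] at this
          rw [← equivariantEval_mul_left hle hα, hF, ← equivariantEval_inducedRep hle hα,
            this, map_smul])
  have hL : ∀ v x, ((L v x : V)) = equivariantEval χ α (β x) v := fun v x => rfl
  have hinj : Function.Injective L := by
    rw [injective_iff_map_eq_zero]
    rintro ⟨v, hv⟩ h0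
    rw [mem_jointEigenspace] at hv
    ext k
    obtain ⟨x, δ, c, hc, hk⟩ := hcover (α k)
    obtain ⟨p, q, rfl⟩ := (hTE.mem_centralizer_iff c).mp hc
    have h1 : equivariantEval χ α (β x) v = 0 := by
      rw [← hL ⟨v, mem_jointEigenspace.mpr hv⟩ x, h0]
      rfl
    change v k = 0
    rw [← equivariantEval_coset_rep hα χ v k, hk, mul_assoc, ← Subgroup.coe_mul,
      equivariantEval_mul_left hle hα, Subgroup.coe_mul, ← equivariantEval_inducedRep hle hα,
      hψ v hv.1 hv.2, map_smul, h1, smul_zero, map_zero]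
  have hsurj : Function.Surjective L := by
    intro y
    have hy : ∀ x (p q : ℤ), χ (S x ^ p * F x ^ q) (y x) =
        ((z ^ e x * w ^ i x) ^ p * (w ^ f x) ^ q) • (y x : V) := by
      intro x p q
      have h := mem_jointEigenspace.mp (y x).2
      rw [map_mul, map_zpow, map_zpow, LinearIsometryEquiv.coe_mul, Function.comp_apply,
        LinearIsometryEquiv.zpow_apply_of_eigen _ (zpow_ne_zero _ hw0) h.2, map_smul,
        LinearIsometryEquiv.zpow_apply_of_eigen _
          (mul_ne_zero (zpow_ne_zero _ hz) (zpow_ne_zero _ hw0)) h.1, smul_smul, mul_comm]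
    choose X Δ C hC hdec using hcover
    choose P Q hPQ using fun γ => (hTE.mem_centralizer_iff (C γ)).mp (hC γ)
    -- The inverse of `L`: extend the prescribed values equivariantly from both sides. The claim
    -- `hΦ` is that the chosen decomposition of `γ` does not matter.
    let Φ : Γ → V := fun γ => (z ^ P γ * w ^ Q γ) • χ (Δ γ) (y (X γ))
    have hΦ : ∀ (γ : Γ) x (δ : Γ₁) (p q : ℤ), (γ : PSL2C) = δ * β x * (T ^ p * E ^ q : Γ) →
        Φ γ = (z ^ p * w ^ q) • χ δ (y x) := by
      intro γ x δ p q h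
      have h1 : (δ : PSL2C) * β x * (T ^ p * E ^ q : Γ) =
          Δ γ * β (X γ) * (T ^ P γ * E ^ Q γ : Γ) := by rw [← h, hdec γ, hPQ γ]
      have hcm : ∀ p q p' q' : ℤ, (T ^ p * E ^ q) * (T ^ p' * E ^ q')⁻¹ =
          T ^ (p - p') * E ^ (q - q') := by
        intro p q p' q'
        rw [zpow_sub, zpow_sub, mul_inv_rev, mul_assoc, ← mul_assoc (E ^ q),
          ← zpow_neg T, ← zpow_neg E, ← zpow_add,
          ((hTE.commute.zpow_zpow (-p') (q + -q')).eq).symm, ← mul_assoc]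
      have h2 : ((Δ γ)⁻¹ * δ : PSL2C) * β x =
          β (X γ) * (T ^ (P γ - p) * E ^ (Q γ - q) : Γ) := by
        rw [← hcm, Subgroup.coe_mul, Subgroup.coe_inv Γ, ← mul_assoc, eq_mul_inv_iff_mul_eq,
          mul_assoc, mul_assoc, Subgroup.coe_inv, inv_mul_eq_iff_eq_mul, ← mul_assoc, h1, mul_assoc]
      have hmem : ∀ p q : ℤ, T ^ p * E ^ q ∈ Subgroup.centralizer {T} := fun p q =>
        (hTE.mem_centralizer_iff _).mpr ⟨p, q, rfl⟩
      have hX : X γ = x := by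
        refine hdisj (X γ) x (δ⁻¹ * Δ γ) _ (hmem (P γ - p) (Q γ - q)) ?_
        rw [mul_assoc, ← h2]
        simp [mul_assoc]
      rw [hX] at h2
      -- Two decompositions differ by an element of `Γ₁ ∩ β C(T) β⁻¹`, which `S x` and `F x`
      -- generate; on `y x` it acts through `θ`.
      obtain ⟨k, m, hkm⟩ := hcent x ((Δ γ)⁻¹ * δ) _ (hmem _ _) (by simpa using h2)
      -- powers of `S x` and `F x` are conjugate to elements of the centralizer
      have hSk : ∀ k : ℤ, ((S x ^ k : Γ₁) : PSL2C) = β x * ((T ^ e x * E ^ i x : Γ) ^ k : Γ) *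
          (β x : PSL2C)⁻¹ := by
        intro k
        rw [Subgroup.coe_zpow, Subgroup.coe_zpow, ← conj_zpow, ← hS, mul_inv_cancel_right]
      have hFm : ∀ m : ℤ, ((F x ^ m : Γ₁) : PSL2C) = β x * ((E ^ f x : Γ) ^ m : Γ) *
          (β x : PSL2C)⁻¹ := by
        intro k
        rw [Subgroup.coe_zpow, Subgroup.coe_zpow, ← conj_zpow, ← hF, mul_inv_cancel_right]
      have h3 : T ^ (P γ - p) * E ^ (Q γ - q) = T ^ (e x * k) * E ^ (i x * k + f x * m) := by
        have h4 : ((S x ^ k * F x ^ m : Γ₁) : PSL2C) * β x =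
            β x * (T ^ (P γ - p) * E ^ (Q γ - q) : Γ) := by
          rw [← hkm, ← h2]
          simp
        rw [Subgroup.coe_mul, hSk, hFm] at h4
        have h5 : (T ^ e x * E ^ i x : Γ) ^ k * (E ^ f x) ^ m =
            T ^ (P γ - p) * E ^ (Q γ - q) := by
          apply Subtype.ext
          rw [Subgroup.coe_mul]
          apply mul_left_cancel (a := (β x : PSL2C))
          rw [← h4]
          group
        rw [← h5, (hTE.commute.zpow_zpow _ _).mul_zpow, ← zpow_mul, ← zpow_mul, ← zpow_mul,
          mul_assoc, ← zpow_add]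
      obtain ⟨h6, h7⟩ := hchar _ _ _ _ h3
      have h8 : χ ((Δ γ)⁻¹ * δ) (y x) = (z ^ (P γ - p) * w ^ (Q γ - q)) • (y x : V) := by
        rw [hkm, hy, h6, h7, mul_zpow, ← zpow_mul, ← zpow_mul, ← zpow_mul, zpow_add₀ hw0,
          mul_assoc]
      have h9 : χ δ (y x) = (z ^ (P γ - p) * w ^ (Q γ - q)) • χ (Δ γ) (y x) := by
        rw [← map_smul, ← h8, ← Function.comp_apply (f := χ (Δ γ)),
          ← LinearIsometryEquiv.coe_mul, ← map_mul, mul_inv_cancel_left]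
      simp only [Φ]
      rw [hX, h9, smul_smul]
      congr 1
      rw [zpow_sub₀ hz, zpow_sub₀ hw0]
      field_simp
    let v : PiLp 2 (fun _ : Fin n => V) := WithLp.toLp 2 fun k => Φ (α k)
    have hΦT : ∀ (γ : Γ) (p q : ℤ), Φ (γ * (T ^ p * E ^ q)) = (z ^ p * w ^ q) • Φ γ := by
      intro γ p q
      rw [hΦ (γ * (T ^ p * E ^ q)) (X γ) (Δ γ) (P γ + p) (Q γ + q)]
      · simp only [Φ]
        rw [smul_smul, zpow_add₀ hz, zpow_add₀ hw0]
        congr 1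
        ring
      · rw [Subgroup.coe_mul, hdec γ, mul_assoc, hPQ γ, ← Subgroup.coe_mul]
        congr 2
        rw [zpow_add, zpow_add, mul_assoc, ← mul_assoc (E ^ Q γ),
          ← (hTE.commute.zpow_zpow p (Q γ)).eq]
        simp only [mul_assoc]
    have hv : ∀ γ : Γ, equivariantEval χ α γ v = Φ γ := by
      intro γ
      obtain ⟨j, hj, -⟩ := hα γ
      rw [equivariantEval_of_mem hα χ γ v j hj]
      change χ _ (Φ (α j)) = _
      rw [hΦ γ (X (α j)) (⟨_, hj⟩ * Δ (α j)) (P (α j)) (Q (α j))]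
      · simp only [Φ]
        rw [map_smul, map_mul]
        rfl
      · have := hdec (α j)
        rw [hPQ (α j)] at this
        rw [Subgroup.coe_mul, mul_assoc, mul_assoc, ← mul_assoc (Δ (α j) : PSL2C), ← this]
        simp
    have hvmem : v ∈ jointEigenspace
        ((inducedRep hα χ T).toLinearEquiv : PiLp 2 (fun _ : Fin n => V) →ₗ[ℂ] _)
        ((inducedRep hα χ E).toLinearEquiv : PiLp 2 (fun _ : Fin n => V) →ₗ[ℂ] _) z w := by
      rw [mem_jointEigenspace]
      constructor
      · ext k
        change equivariantEval χ α ((α k * T : Γ) : PSL2C) v = z • Φ (α k)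
        rw [hv]
        simpa using hΦT (α k) 1 0
      · ext k
        change equivariantEval χ α ((α k * E : Γ) : PSL2C) v = w • Φ (α k)
        rw [hv]
        simpa using hΦT (α k) 0 1
    refine ⟨⟨v, hvmem⟩, ?_⟩
    ext x
    rw [hL]
    change equivariantEval χ α (β x) v = _
    rw [hv, hΦ (β x) x 1 0 0 (by simp)]
    simp
  rw [(LinearEquiv.ofBijective L ⟨hinj, hsurj⟩).finrank_eq, Module.finrank_pi_fintype]

end Induced

/-! ### Local factors -/

/-- The product of `1 - z u` over the `e`-th roots `z` of `y`. -/
theorem prod_nthRoots_one_sub_mul {e : ℕ} (he : 0 < e) (y : ℂ) {u : ℂ} (hu : u ≠ 0) :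
    ((Polynomial.nthRoots e y).map fun z => 1 - z * u).prod = 1 - y * u ^ e := by
  have hmonic : (Polynomial.X ^ e - Polynomial.C y : Polynomial ℂ).Monic :=
    Polynomial.monic_X_pow_sub_C y he.ne'
  have hcard := (Complex.isPrimitiveRoot_exp e he.ne').card_nthRoots y
  rw [if_pos (IsAlgClosed.exists_pow_nat_eq y he)] at hcard
  have h := Polynomial.prod_multiset_X_sub_C_of_monic_of_roots_card_eq hmonic (by
    rw [Polynomial.natDegree_X_pow_sub_C]
    exact hcard)
  -- Factor `X^e - y` over its roots, evaluate at `u⁻¹`, and multiply by `u^e`.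
  have h' := congrArg (Polynomial.eval u⁻¹) h
  rw [Polynomial.eval_multiset_prod, Multiset.map_map] at h'
  simp only [Function.comp_def, Polynomial.eval_sub, Polynomial.eval_X, Polynomial.eval_C,
    Polynomial.eval_pow] at h'
  have hmap : ((Polynomial.nthRoots e y).map fun z => 1 - z * u) =
      (Polynomial.nthRoots e y).map fun z => u * (u⁻¹ - z) :=
    Multiset.map_congr rfl fun z _ => by field_simp
  rw [hmap, Multiset.prod_map_mul, Multiset.map_const', Multiset.prod_replicate, hcard,
    show Polynomial.nthRoots e y = (Polynomial.X ^ e - Polynomial.C y : Polynomial ℂ).roots from rfl,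
    h', mul_sub, ← mul_pow, mul_inv_cancel₀ hu, one_pow, mul_comm y]

theorem count_nthRoots {e : ℕ} (he : 0 < e) {y : ℂ} (hy : y ≠ 0) (z : ℂ) :
    (Polynomial.nthRoots e y).count z = if z ^ e = y then 1 else 0 := by
  rw [Multiset.count_eq_of_nodup ((Complex.isPrimitiveRoot_exp e he.ne').nthRoots_nodup hy)]
  simp only [Polynomial.mem_nthRoots he]

theorem card_nthRoots_complex {e : ℕ} (he : 0 < e) (y : ℂ) :
    (Polynomial.nthRoots e y).card = e := by
  rw [(Complex.isPrimitiveRoot_exp e he.ne').card_nthRoots y,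
    if_pos (IsAlgClosed.exists_pow_nat_eq y he)]

/-- The factor `A^{-k} conj(A^{-l}) |A|^{-s-1}` in terms of the multiplier `A = a²`. -/
noncomputable def eulerWeight (s : ℂ) (l k : ℕ) : ℂ →* ℂ where
  toFun A := A ^ (-(k : ℤ)) * (starRingEnd ℂ) (A ^ (-(l : ℤ))) * (‖A‖ : ℂ) ^ (-s - 1)
  map_one' := by simp
  map_mul' A B := by
    rw [norm_mul, Complex.ofReal_mul,
      Complex.mul_cpow_ofReal_nonneg (norm_nonneg _) (norm_nonneg _), mul_zpow, mul_zpow, map_mul]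
    ring

theorem eulerWeight_apply (s : ℂ) (l k : ℕ) (A : ℂ) : eulerWeight s l k A =
    A ^ (-(k : ℤ)) * (starRingEnd ℂ) (A ^ (-(l : ℤ))) * (‖A‖ : ℂ) ^ (-s - 1) := rfl

/-- Here `conj A = A⁻¹`. For `A = (ζ²)^i` the weight is therefore the power `-i` of the selected
eigenvalue, which absorbs the rotational part of `T₁`. -/
theorem eulerWeight_of_norm_eq_one (s : ℂ) (l k : ℕ) {A : ℂ} (hA : ‖A‖ = 1) :
    eulerWeight s l k A = A ^ ((l : ℤ) - k) := by
  have h0 : A ≠ 0 := norm_pos_iff.mp (by rw [hA]; exact one_pos)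
  have hc : (starRingEnd ℂ) A = A⁻¹ := (Complex.inv_eq_conj hA).symm
  rw [eulerWeight_apply, hA, Complex.ofReal_one, Complex.one_cpow, mul_one, map_zpow₀, hc,
    zpow_neg A⁻¹, inv_zpow, inv_inv, ← zpow_add₀ h0, sub_eq_neg_add]

theorem norm_eulerWeight (s : ℂ) (l k : ℕ) {A : ℂ} (hA : A ≠ 0) :
    ‖eulerWeight s l k A‖ = ‖A‖⁻¹ ^ l * ‖A‖⁻¹ ^ k * ‖A‖ ^ (-s.re - 1) := by
  rw [eulerWeight_apply, norm_mul, norm_mul, RCLike.norm_conj, norm_zpow, norm_zpow,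
    Complex.norm_cpow_eq_rpow_re_of_pos (norm_pos_iff.mpr hA)]
  simp only [zpow_neg, zpow_natCast, inv_pow, Complex.sub_re, Complex.neg_re, Complex.one_re]
  ring

theorem eulerWeight_ne_zero (s : ℂ) (l k : ℕ) {A : ℂ} (hA : A ≠ 0) :
    eulerWeight s l k A ≠ 0 := by
  have : 0 < ‖A‖ := norm_pos_iff.mpr hA
  rw [← norm_pos_iff, norm_eulerWeight s l k hA]
  positivity

theorem norm_eulerWeight_le_one {s : ℂ} (hs : 1 < s.re) (l k : ℕ) {A : ℂ} (hA : 1 < ‖A‖) :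
    ‖eulerWeight s l k A‖ ≤ 1 := by
  rw [norm_eulerWeight s l k (norm_pos_iff.mp (one_pos.trans hA))]
  have h1 : ‖A‖⁻¹ ≤ 1 := inv_le_one_of_one_le₀ hA.le
  have h0 : 0 ≤ ‖A‖⁻¹ := inv_nonneg.mpr (norm_nonneg _)
  exact mul_le_one₀ (mul_le_one₀ (pow_le_one₀ h0 h1) (pow_nonneg h0 _) (pow_le_one₀ h0 h1))
    (Real.rpow_nonneg (norm_nonneg _) _) (Real.rpow_le_one_of_one_le_of_nonpos hA.le (by linarith))

theorem summable_norm_eulerWeight (s : ℂ) {A : ℂ} (hA : 1 < ‖A‖) :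
    Summable fun p : ℕ × ℕ => ‖eulerWeight s p.1 p.2 A‖ := by
  simp only [norm_eulerWeight s _ _ (norm_pos_iff.mp (one_pos.trans hA))]
  refine Summable.mul_right _ ?_
  have h := summable_geometric_of_lt_one (inv_nonneg.mpr (norm_nonneg A))
    (inv_lt_one_of_one_lt₀ hA)
  exact h.mul_of_nonneg h (fun _ => by positivity) (fun _ => by positivity)

theorem multipliable_one_sub_of_summable {κ : Type*} {f : κ → ℂ}
    (hf : Summable fun q => ‖f q‖) : Multipliable fun q => 1 - f q := by
  simp only [sub_eq_add_neg]
  exact multipliable_one_add_of_summable (by simpa only [norm_neg] using hf)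

/-! ### Local factors grouped by the pairs `(l, k)` -/

namespace EulerSystem

variable {W : Type*} [NormedAddCommGroup W] [InnerProductSpace ℂ W]
  {Γ : Subgroup PSL2C} {ρ : Γ →* (W ≃ₗᵢ[ℂ] W)}

theorem one_lt_norm_sq (D : EulerSystem Γ ρ) (T : D.R) : 1 < ‖(D.a T : ℂ) ^ 2‖ := by
  rw [norm_pow]
  exact (one_lt_sq_iff₀ (norm_nonneg _)).mpr (D.one_lt_norm_a T)

theorem diagonalizes (D : EulerSystem Γ ρ) (T : D.R) : Diagonalizes (D.g T) (T : Γ) :=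
  ⟨D.a T, D.one_lt_norm_a T, D.conj_T T⟩

theorem norm_zeta_eq_one (D : EulerSystem Γ ρ) (T : D.R) : ‖(D.ζ T : ℂ)‖ = 1 :=
  (D.primitiveRoot T).norm'_eq_one (by have := (D.splits T).finite.orderOf_pos; omega)

theorem norm_t (D : EulerSystem Γ ρ) (T : D.R) (j : Fin (Module.finrank ℂ W)) :
    ‖D.t T j‖ = 1 := by
  have h := congrArg norm (D.eigen_T T j)
  rw [LinearIsometryEquiv.norm_map, norm_smul] at h
  exact (mul_eq_right₀ (norm_ne_zero_iff.mpr ((D.b T).ne_zero j))).mp h.symm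

/-- The eigenvalue of `ρ(E)` that is selected by the pair `(l, k)`. -/
noncomputable def selected (D : EulerSystem Γ ρ) (T : D.R) (p : ℕ × ℕ) : ℂ :=
  ((D.ζ T : ℂ) ^ 2) ^ ((p.2 : ℤ) - p.1)

theorem c_eq_one_iff (D : EulerSystem Γ ρ) (T : D.R) (j : Fin (Module.finrank ℂ W))
    (p : ℕ × ℕ) : D.c T j p.1 p.2 = 1 ↔ D.t' T j = D.selected T p := by
  have h0 := (D.ζ T).ne_zero
  have h : (D.ζ T : ℂ) ^ (2 * (p.1 : ℤ)) * (D.ζ T : ℂ) ^ (-2 * (p.2 : ℤ)) =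
      (D.selected T p)⁻¹ := by
    rw [selected, ← zpow_add₀ h0, ← zpow_natCast, ← zpow_mul, ← zpow_neg]
    congr 1
    push_cast
    ring
  rw [c, mul_assoc, h, mul_inv_eq_one₀]
  exact zpow_ne_zero _ (pow_ne_zero _ h0)

theorem term_eq (D : EulerSystem Γ ρ) (s : ℂ) (T : D.R) (j : Fin (Module.finrank ℂ W))
    (l k : ℕ) : D.term s T j l k = D.t T j * eulerWeight s l k ((D.a T : ℂ) ^ 2) := by
  have h : ∀ k : ℕ, ((D.a T : ℂ) ^ 2) ^ (-(k : ℤ)) = (D.a T : ℂ) ^ (-2 * (k : ℤ)) := fun k => by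
    rw [← zpow_natCast, ← zpow_mul]
    congr 1
    push_cast
    ring
  rw [term, eulerWeight_apply, N, norm_pow, h, h]
  ring

theorem norm_term (D : EulerSystem Γ ρ) (s : ℂ) (T : D.R) (j : Fin (Module.finrank ℂ W))
    (l k : ℕ) : ‖D.term s T j l k‖ = ‖eulerWeight s l k ((D.a T : ℂ) ^ 2)‖ := by
  rw [term_eq, norm_mul, norm_t, one_mul]

/-- The indices of the eigenvectors that occur in the factor of `(l, k)`. -/
noncomputable def indices (D : EulerSystem Γ ρ) (T : D.R) (p : ℕ × ℕ) :
    Finset (Fin (Module.finrank ℂ W)) :=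
  Finset.univ.filter fun j => D.t' T j = D.selected T p

theorem mem_indices (D : EulerSystem Γ ρ) (T : D.R) (p : ℕ × ℕ)
    (j : Fin (Module.finrank ℂ W)) : j ∈ D.indices T p ↔ D.t' T j = D.selected T p := by
  simp [indices]

/-- The factor of the pair `(l, k)` in the local factor of `T₀`. -/
noncomputable def pairFactor (D : EulerSystem Γ ρ) (s : ℂ) (T : D.R) (p : ℕ × ℕ) : ℂ :=
  ∏ j ∈ D.indices T p, (1 - D.t T j * eulerWeight s p.1 p.2 ((D.a T : ℂ) ^ 2))

theorem summable_norm_term (D : EulerSystem Γ ρ) (s : ℂ) (T : D.R)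
    (j : Fin (Module.finrank ℂ W)) : Summable fun p : ℕ × ℕ => ‖D.term s T j p.1 p.2‖ := by
  simp only [norm_term]
  exact summable_norm_eulerWeight s (D.one_lt_norm_sq T)

theorem multipliable_pairs (D : EulerSystem Γ ρ) (s : ℂ) (T : D.R)
    (j : Fin (Module.finrank ℂ W)) :
    Multipliable fun p : D.Pairs T j => 1 - D.term s T j p.1.1 p.1.2 :=
  multipliable_one_sub_of_summable
    ((D.summable_norm_term s T j).comp_injective Subtype.val_injective)

/-- Interchanges the products over `j` and over `(l, k)`: the comparison of `ψ` with `χ` works for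
one pair at a time, since the pair fixes the eigenvalue of `E`. -/
theorem hasProd_pairFactor (D : EulerSystem Γ ρ) (s : ℂ) (T : D.R) :
    HasProd (D.pairFactor s T) (D.localFactor s T) := by
  have h : ∀ j ∈ Finset.univ, HasProd
      (Set.mulIndicator {p : ℕ × ℕ | D.c T j p.1 p.2 = 1} fun p => 1 - D.term s T j p.1 p.2)
      (∏' p : D.Pairs T j, (1 - D.term s T j p.1.1 p.1.2)) := fun j _ =>
    hasProd_subtype_iff_mulIndicator.mp (D.multipliable_pairs s T j).hasProd
  convert hasProd_prod h using 1
  · funext p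
    rw [pairFactor, indices, Finset.prod_filter]
    refine Finset.prod_congr rfl fun j _ => ?_
    simp only [Set.mulIndicator_apply, Set.mem_ofPred_eq, c_eq_one_iff, term_eq]
  · rfl

end EulerSystem

/-! ### Oriented axes of a subgroup of finite index -/

namespace EulerSystem

section Over

variable {V W : Type*} [NormedAddCommGroup V] [InnerProductSpace ℂ V]
  [NormedAddCommGroup W] [InnerProductSpace ℂ W] {Γ₁ Γ : Subgroup PSL2C}
  {χ : Γ₁ →* (V ≃ₗᵢ[ℂ] V)} {ρ : Γ →* (W ≃ₗᵢ[ℂ] W)}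

/-- `β` maps the oriented axis of `T` to that of `T₁`. -/
def IsOver (D₁ : EulerSystem Γ₁ χ) (D : EulerSystem Γ ρ) (T₁ : D₁.R) (T : D.R) (β : Γ) : Prop :=
  D₁.g T₁ * β * (D.g T)⁻¹ ∈ torus

variable {D₁ : EulerSystem Γ₁ χ} {D : EulerSystem Γ ρ}

theorem exists_representative (hΓ : IsKleinian Γ) (D : EulerSystem Γ ρ) {g : PSL2C} {T : Γ}
    (hT : Diagonalizes g T) : ∃ (T₀ : D.R) (γ : Γ), g * γ * (D.g T₀)⁻¹ ∈ torus := by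
  obtain ⟨T', hT', hprim⟩ := hΓ.exists_primitive hT
  obtain ⟨T₀, hT₀, h⟩ := D.isMaximalReduced.maximal T' hprim
  exact ⟨⟨T₀, hT₀⟩, (sameDirectedCentralizer_iff hT' (D.diagonalizes ⟨T₀, hT₀⟩)).mp h⟩

theorem exists_isOver (hΓ : IsKleinian Γ) (hle : Γ₁ ≤ Γ) (D₁ : EulerSystem Γ₁ χ)
    (D : EulerSystem Γ ρ) (T₁ : D₁.R) : ∃ (T : D.R) (β : Γ), D₁.IsOver D T₁ T β :=
  D.exists_representative hΓ (T := ⟨((T₁ : Γ₁) : PSL2C), hle (T₁ : Γ₁).2⟩) (D₁.diagonalizes T₁)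

theorem IsOver.unique {T₁ : D₁.R} {T T' : D.R} {β β' : Γ} (h : D₁.IsOver D T₁ T β)
    (h' : D₁.IsOver D T₁ T' β') : T = T' := by
  refine Subtype.ext (D.isMaximalReduced.reduced T T.2 T' T'.2 ?_)
  refine (sameDirectedCentralizer_iff (D.diagonalizes T) (D.diagonalizes T')).mpr ⟨β⁻¹ * β', ?_⟩
  convert torus.mul_mem (torus.inv_mem h) h' using 1
  simp [mul_assoc]

theorem IsOver.eq_of_mem {T₁ T₁' : D₁.R} {T : D.R} {β β' : Γ} (h : D₁.IsOver D T₁ T β)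
    (h' : D₁.IsOver D T₁' T β') {δ : Γ₁} {c : Γ} (hc : c ∈ Subgroup.centralizer {(T : Γ)})
    (e : (β' : PSL2C) = δ * β * c) : T₁ = T₁' := by
  refine Subtype.ext (D₁.isMaximalReduced.reduced T₁ T₁.2 T₁' T₁'.2 ?_)
  rw [(D.diagonalizes T).mem_centralizer_iff] at hc
  refine (sameDirectedCentralizer_iff (D₁.diagonalizes T₁) (D₁.diagonalizes T₁')).mpr ⟨δ⁻¹, ?_⟩
  have := torus.mul_mem (torus.mul_mem h hc) (torus.inv_mem h')
  convert this using 1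
  rw [e]
  simp [mul_assoc]

/-- By finite index a positive power of `γ T γ⁻¹` lies in `Γ₁`, and it has the same oriented axis;
so every double coset is reached by some `T₁`. -/
theorem exists_isOver_mul (hΓ : IsKleinian Γ) (hle : Γ₁ ≤ Γ)
    (hindex : (Γ₁.subgroupOf Γ).index ≠ 0) (D₁ : EulerSystem Γ₁ χ) (D : EulerSystem Γ ρ)
    (T : D.R) (γ : Γ) : ∃ (T₁ : D₁.R) (δ : Γ₁),
      D₁.IsOver D T₁ T (⟨δ, hle δ.2⟩ * γ) := by
  obtain ⟨m, hm, -, hmem⟩ := Subgroup.exists_pow_mem_of_index_ne_zero hindex (γ * T * γ⁻¹)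
  have hd : Diagonalizes (D.g T * (γ : PSL2C)⁻¹) ((γ * T * γ⁻¹ : Γ) : PSL2C) := by
    have : Diagonalizes (D.g T * (γ : PSL2C)⁻¹) ((γ : PSL2C) * T * (γ : PSL2C)⁻¹) := by
      rw [diagonalizes_conj, inv_mul_cancel_right]
      exact D.diagonalizes T
    simpa using this
  obtain ⟨T₁, δ, h⟩ := D₁.exists_representative (hΓ.mono hle)
    (T := ⟨((γ * T * γ⁻¹ : Γ) : PSL2C) ^ m, by simpa using Subgroup.mem_subgroupOf.mp hmem⟩) (hd.pow hm.ne')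
  refine ⟨T₁, δ⁻¹, ?_⟩
  unfold IsOver
  convert torus.inv_mem h using 1
  simp [mul_assoc]

theorem IsOver.mem_centralizer_iff {T₁ : D₁.R} {T : D.R} {β : Γ} (h : D₁.IsOver D T₁ T β)
    {δ : Γ₁} {c : Γ} (e : (δ : PSL2C) * β = β * c) :
    δ ∈ Subgroup.centralizer {(T₁ : Γ₁)} ↔ c ∈ Subgroup.centralizer {(T : Γ)} := by
  rw [(D.diagonalizes T).mem_centralizer_iff, (D₁.diagonalizes T₁).mem_centralizer_iff]
  have hδ : D₁.g T₁ * δ * (D₁.g T₁)⁻¹ = (D₁.g T₁ * β * (D.g T)⁻¹) *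
      (D.g T * c * (D.g T)⁻¹) * (D₁.g T₁ * β * (D.g T)⁻¹)⁻¹ := by
    rw [eq_mul_inv_of_mul_eq e]
    group
  rw [hδ]
  constructor
  · intro h'
    have := torus.mul_mem (torus.mul_mem (torus.inv_mem h) h') h
    convert this using 1
    group
  · intro h'
    exact torus.mul_mem (torus.mul_mem h h') (torus.inv_mem h)

/-- The two frames differ by a torus element, which does not affect diagonal forms because the torus
is abelian. -/
theorem IsOver.conj_eq {T₁ : D₁.R} {T : D.R} {β : Γ} (h : D₁.IsOver D T₁ T β)
    {δ : Γ₁} {c : Γ} (e : (δ : PSL2C) * β = β * c) {a : ℂˣ}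
    (ha : D₁.g T₁ * δ * (D₁.g T₁)⁻¹ = diagPSL a) : D.g T * c * (D.g T)⁻¹ = diagPSL a := by
  have hcomm := (torus_commute h (diagPSL_mem_torus a)).eq
  rw [eq_mul_inv_of_mul_eq e] at ha
  have : D.g T * c * (D.g T)⁻¹ =
      (D₁.g T₁ * β * (D.g T)⁻¹)⁻¹ * diagPSL a * (D₁.g T₁ * β * (D.g T)⁻¹) := by
    rw [← ha]
    group
  rw [this, mul_assoc, ← hcomm, inv_mul_cancel_left]

theorem conj_zpow_mul_zpow (D : EulerSystem Γ ρ) (T : D.R) (p q : ℤ) :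
    D.g T * (((T : Γ) ^ p * D.E T ^ q : Γ) : PSL2C) * (D.g T)⁻¹ =
      diagPSL (D.a T ^ p * D.ζ T ^ q) := by
  rw [diagPSL_mul, ← diagHom_apply, ← diagHom_apply, map_zpow, map_zpow, diagHom_apply,
    diagHom_apply, ← D.conj_T, ← D.conj_E, conj_zpow, conj_zpow]
  simp [mul_assoc]

theorem zpow_eq_one (D : EulerSystem Γ ρ) (T : D.R) {p : ℤ} (h : (T : Γ) ^ p = 1) : p = 0 := by
  have h1 := D.conj_zpow_mul_zpow T p 0
  rw [h] at h1
  simp only [zpow_zero, mul_one, OneMemClass.coe_one, mul_inv_cancel] at h1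
  have h2 := congrArg norm ((diagPSL_eq_one_iff _).mp h1.symm)
  rw [norm_pow, Units.val_zpow_eq_zpow_val, norm_zpow, norm_one, ← zpow_natCast, ← zpow_mul,
    zpow_eq_one_iff_right₀ (norm_nonneg _) (D.one_lt_norm_a T).ne'] at h2
  omega

/-- The generators of the centralizer in `Γ₁` in terms of those of the centralizer in `Γ`. -/
theorem IsOver.exists_exponents (hle : Γ₁ ≤ Γ) {T₁ : D₁.R} {T : D.R} {β : Γ}
    (h : D₁.IsOver D T₁ T β) : ∃ (e : ℕ) (i f : ℤ), 0 < e ∧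
      ((T₁ : Γ₁) : PSL2C) * β = β * ((T : Γ) ^ (e : ℤ) * D.E T ^ i : Γ) ∧
      (D₁.E T₁ : PSL2C) * β = β * (D.E T ^ f : Γ) ∧
      (D₁.a T₁ : ℂ) ^ 2 = ((D.a T : ℂ) ^ 2) ^ e * ((D.ζ T : ℂ) ^ 2) ^ i ∧
      (D₁.ζ T₁ : ℂ) ^ 2 = ((D.ζ T : ℂ) ^ 2) ^ f := by
  have key : ∀ δ : Γ₁, δ ∈ Subgroup.centralizer {(T₁ : Γ₁)} → ∃ p q : ℤ,
      (δ : PSL2C) * β = β * ((T : Γ) ^ p * D.E T ^ q : Γ) := by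
    intro δ hδ
    have e : (δ : PSL2C) * β = β * (β⁻¹ * ⟨δ, hle δ.2⟩ * β : Γ) := by simp [mul_assoc]
    obtain ⟨p, q, hpq⟩ := ((D.splits T).mem_centralizer_iff _).mp
      ((h.mem_centralizer_iff e).mp hδ)
    exact ⟨p, q, by rw [e, hpq]⟩
  have hsq : ∀ (p q : ℤ) (b : ℂˣ), D.g T * (((T : Γ) ^ p * D.E T ^ q : Γ) : PSL2C) * (D.g T)⁻¹ =
      diagPSL b → (b : ℂ) ^ 2 = ((D.a T : ℂ) ^ 2) ^ p * ((D.ζ T : ℂ) ^ 2) ^ q := by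
    intro p q b hb
    rw [conj_zpow_mul_zpow, diagPSL_eq_iff] at hb
    rw [← hb, Units.val_mul, Units.val_zpow_eq_zpow_val, Units.val_zpow_eq_zpow_val, mul_pow,
      ← zpow_natCast, ← zpow_natCast, ← zpow_natCast, ← zpow_natCast, ← zpow_mul, ← zpow_mul,
      ← zpow_mul, ← zpow_mul, mul_comm p, mul_comm q]
  have hnorm : ∀ (p q : ℤ), ‖((D.a T : ℂ) ^ 2) ^ p * ((D.ζ T : ℂ) ^ 2) ^ q‖ =
      ‖(D.a T : ℂ) ^ 2‖ ^ p := by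
    intro p q
    rw [norm_mul, norm_zpow, norm_zpow, norm_pow (D.ζ T : ℂ), norm_zeta_eq_one, one_pow, one_zpow,
      mul_one]
  obtain ⟨p, q, hpq⟩ := key T₁ (Subgroup.mem_centralizer_singleton_iff.mpr rfl)
  obtain ⟨p', q', hpq'⟩ := key (D₁.E T₁)
    (Subgroup.mem_centralizer_singleton_iff.mpr (D₁.splits T₁).commute.eq.symm)
  have h1 := hsq p q _ (h.conj_eq hpq (D₁.conj_T T₁))
  have h2 := hsq p' q' _ (h.conj_eq hpq' (D₁.conj_E T₁))
  -- Absolute values decide the exponents: `|a₁²| = |a²|^p` exceeds one, so `p > 0`, whereas `|ζ₁| =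
  -- 1` forces `p' = 0`.
  have hp : 0 < p := by
    have := D₁.one_lt_norm_sq T₁
    rw [h1, hnorm] at this
    exact (one_lt_zpow_iff_right₀ (D.one_lt_norm_sq T)).mp this
  have hp' : p' = 0 := by
    have := congrArg norm h2
    rw [hnorm, norm_pow, norm_zeta_eq_one, one_pow] at this
    exact (zpow_eq_one_iff_right₀ (norm_nonneg _) (D.one_lt_norm_sq T).ne').mp this.symm
  subst hp'
  lift p to ℕ using hp.le
  refine ⟨p, q, q', by exact_mod_cast hp, hpq, by simpa using hpq', by simpa using h1,
    by simpa using h2⟩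

end Over
end EulerSystem

/-! ### Comparison of the Euler products -/

theorem Multiset.prod_map_finset_sum {κ M N : Type*} [CommMonoid N] (S : Finset κ)
    (m : κ → Multiset M) (φ : M → N) :
    ((∑ x ∈ S, m x).map φ).prod = ∏ x ∈ S, ((m x).map φ).prod := by
  classical
  induction S using Finset.induction_on with
  | empty => simp
  | insert a S ha ih => rw [Finset.sum_insert ha, Multiset.map_add, Multiset.prod_add, ih,
      Finset.prod_insert ha]

namespace EulerSystem

theorem selected_pow_orderOf {W : Type*} [NormedAddCommGroup W] [InnerProductSpace ℂ W]
    {Γ : Subgroup PSL2C} {ρ : Γ →* (W ≃ₗᵢ[ℂ] W)} (D : EulerSystem Γ ρ) (T : D.R) (p : ℕ × ℕ) :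
    D.selected T p ^ orderOf (D.E T) = 1 := by
  rw [selected, ← zpow_natCast, zpow_comm, zpow_natCast, ← pow_mul, (D.primitiveRoot T).pow_eq_one,
    one_zpow]

theorem selected_ne_zero {W : Type*} [NormedAddCommGroup W] [InnerProductSpace ℂ W]
    {Γ : Subgroup PSL2C} {ρ : Γ →* (W ≃ₗᵢ[ℂ] W)} (D : EulerSystem Γ ρ) (T : D.R) (p : ℕ × ℕ) :
    D.selected T p ≠ 0 :=
  zpow_ne_zero _ (pow_ne_zero _ (D.ζ T).ne_zero)

theorem t_ne_zero {W : Type*} [NormedAddCommGroup W] [InnerProductSpace ℂ W]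
    {Γ : Subgroup PSL2C} {ρ : Γ →* (W ≃ₗᵢ[ℂ] W)} (D : EulerSystem Γ ρ) (T : D.R)
    (j : Fin (Module.finrank ℂ W)) : D.t T j ≠ 0 :=
  norm_ne_zero_iff.mp (by rw [norm_t]; exact one_ne_zero)

theorem card_filter_eq_finrank {W : Type*} [NormedAddCommGroup W] [InnerProductSpace ℂ W]
    {Γ : Subgroup PSL2C} {ρ : Γ →* (W ≃ₗᵢ[ℂ] W)} (D : EulerSystem Γ ρ) (T : D.R) (z w : ℂ) :
    (Finset.univ.filter fun j => D.t T j = z ∧ D.t' T j = w).card =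
      Module.finrank ℂ (jointEigenspace ((ρ (T : Γ)).toLinearEquiv : W →ₗ[ℂ] W)
        ((ρ (D.E T)).toLinearEquiv : W →ₗ[ℂ] W) z w) :=
  (finrank_jointEigenspace (D.b T) (D.eigen_T T) (D.eigen_E T) z w).symm

section Comparison

variable {V : Type*} [NormedAddCommGroup V] [InnerProductSpace ℂ V]
  {Γ₁ Γ : Subgroup PSL2C} {χ : Γ₁ →* (V ≃ₗᵢ[ℂ] V)} {n : ℕ} {α : Fin n → Γ}
  {hα : IsRightCosetReps Γ₁ Γ α} {D₁ : EulerSystem Γ₁ χ} {D : EulerSystem Γ (inducedRep hα χ)}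

/-- For every pair `(l, k)`, the eigenvalues of `ψ(T)` that occur in the local factor of `T` are
the roots, of appropriate orders, of those that occur in the local factors of the elements `T₁`
over `T`. -/
theorem exists_map_t_eq_sum_nthRoots [FiniteDimensional ℂ V] (hle : Γ₁ ≤ Γ) {T : D.R} {ι : Type*}
    [Fintype ι] (x₁ : ι → D₁.R) (hx₁ : Function.Injective x₁) (β : ι → Γ)
    (hover : ∀ x, D₁.IsOver D (x₁ x) T (β x))
    (hcover : ∀ γ : Γ, ∃ x, ∃ δ : Γ₁, ∃ c ∈ Subgroup.centralizer {(T : Γ)},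
      (γ : PSL2C) = δ * β x * (c : Γ)) :
    ∃ (e : ι → ℕ) (i : ι → ℤ), (∀ x, 0 < e x) ∧
      (∀ x s (p : ℕ × ℕ), eulerWeight s p.1 p.2 ((D₁.a (x₁ x) : ℂ) ^ 2) =
        eulerWeight s p.1 p.2 ((D.a T : ℂ) ^ 2) ^ e x * D.selected T p ^ (-i x)) ∧
      ∀ p : ℕ × ℕ, (D.indices T p).val.map (D.t T) = ∑ x, ∑ j ∈ D₁.indices (x₁ x) p,
        Polynomial.nthRoots (e x) (D₁.t (x₁ x) j * D.selected T p ^ (-i x)) := by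
  classical
  choose e i f he hT hE ha hζ using fun x => (hover x).exists_exponents hle
  refine ⟨e, i, he, fun x s p => ?_, fun p => ?_⟩
  · have h1 : ‖((D.ζ T : ℂ) ^ 2) ^ i x‖ = 1 := by
      rw [norm_zpow, norm_pow, norm_zeta_eq_one, one_pow, one_zpow]
    rw [ha, map_mul, map_pow, eulerWeight_of_norm_eq_one s _ _ h1, selected, ← zpow_mul,
      ← zpow_mul]
    congr 2
    ring
  · have hsel : ∀ x, D₁.selected (x₁ x) p = D.selected T p ^ f x := fun x => by
      rw [selected, selected, hζ, zpow_comm]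
    have hw0 := D.selected_ne_zero T p
    ext z
    have hcount : ∀ x, ∀ j, (Polynomial.nthRoots (e x)
        (D₁.t (x₁ x) j * D.selected T p ^ (-i x))).count z =
        if D₁.t (x₁ x) j = z ^ (e x : ℤ) * D.selected T p ^ i x then 1 else 0 := by
      intro x j
      rw [count_nthRoots (he x) (mul_ne_zero (D₁.t_ne_zero _ _) (zpow_ne_zero _ hw0))]
      congr 1
      rw [zpow_neg, eq_mul_inv_iff_mul_eq₀ (zpow_ne_zero _ hw0), zpow_natCast]
      exact propext eq_comm
    rw [Multiset.count_sum']
    simp only [Multiset.count_sum', hcount, Finset.sum_boole, Nat.cast_id, indices,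
      Finset.filter_filter]
    -- The multiplicity formula needs `z ≠ 0`; zero occurs on neither side, all eigenvalues being of
    -- modulus one.
    by_cases hz : z = 0
    · have hl : z ∉ (Finset.univ.filter fun j => D.t' T j = D.selected T p).val.map (D.t T) := by
        rw [Multiset.mem_map]
        rintro ⟨j, -, hj⟩
        exact D.t_ne_zero T j (hj.trans hz)
      rw [Multiset.count_eq_zero_of_notMem hl]
      symm
      refine Finset.sum_eq_zero fun x _ => ?_
      rw [Finset.card_eq_zero, Finset.filter_eq_empty_iff]
      rintro j - ⟨-, hj⟩
      refine D₁.t_ne_zero _ j (hj.trans ?_)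
      rw [hz, zpow_natCast, zero_pow (he x).ne', zero_mul]
    · have hmackey := finrank_jointEigenspace_inducedRep hle hα χ (D.splits T)
        (fun p => D.zpow_eq_one T) hz (D.selected_pow_orderOf T p) β (fun x => (x₁ x : Γ₁))
        (fun x => D₁.E (x₁ x)) (fun x => e x) i f hT hE
        (fun x δ c hc h => ((D₁.splits (x₁ x)).mem_centralizer_iff δ).mp
          (((hover x).mem_centralizer_iff h).mpr hc))
        hcover (fun x x' δ c hc h => hx₁ ((hover x).eq_of_mem (hover x') hc h))
      rw [← D.card_filter_eq_finrank] at hmackey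
      simp only [← D₁.card_filter_eq_finrank] at hmackey
      rw [Multiset.count_map, ← Finset.filter_val, Finset.card_val, Finset.filter_filter]
      convert hmackey using 2
      · ext j
        simp [and_comm, eq_comm]
      · refine congrArg Finset.card ?_
        ext j
        simp [and_comm, hsel]

/-- Each group of `e`-th roots of `t₁ w^{-i}` contributes `1 - t₁ w^{-i} u^e`, and `w^{-i} u^e` is
the weight of `T₁`. -/
theorem pairFactor_eq_prod [FiniteDimensional ℂ V] (hle : Γ₁ ≤ Γ) {T : D.R} {ι : Type*}
    [Fintype ι] (x₁ : ι → D₁.R) (hx₁ : Function.Injective x₁) (β : ι → Γ)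
    (hover : ∀ x, D₁.IsOver D (x₁ x) T (β x))
    (hcover : ∀ γ : Γ, ∃ x, ∃ δ : Γ₁, ∃ c ∈ Subgroup.centralizer {(T : Γ)},
      (γ : PSL2C) = δ * β x * (c : Γ)) (s : ℂ) (p : ℕ × ℕ) :
    D.pairFactor s T p = ∏ x, D₁.pairFactor s (x₁ x) p := by
  obtain ⟨e, i, he, hu, hroots⟩ := exists_map_t_eq_sum_nthRoots hle x₁ hx₁ β hover hcover
  have hu0 : eulerWeight s p.1 p.2 ((D.a T : ℂ) ^ 2) ≠ 0 :=
    eulerWeight_ne_zero _ _ _ (pow_ne_zero _ (D.a T).ne_zero)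
  have h := congrArg (fun m : Multiset ℂ =>
    (m.map fun z => 1 - z * eulerWeight s p.1 p.2 ((D.a T : ℂ) ^ 2)).prod) (hroots p)
  simp only [Multiset.map_map] at h
  refine h.trans ?_
  rw [Multiset.prod_map_finset_sum]
  refine Finset.prod_congr rfl fun x _ => ?_
  rw [Multiset.prod_map_finset_sum, pairFactor]
  refine Finset.prod_congr rfl fun j _ => ?_
  rw [prod_nthRoots_one_sub_mul (he x) _ hu0, hu]
  ring

/-- Each eigenvalue over `T₁` accounts for `e ≥ 1` eigenvalues of `ψ(T)`, and `|u₁| = |u|^e ≤ |u|`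
because `|u| ≤ 1` for `Re s > 1`. -/
theorem sum_card_mul_norm_le [FiniteDimensional ℂ V] (hle : Γ₁ ≤ Γ) {T : D.R} {ι : Type*}
    [Fintype ι] (x₁ : ι → D₁.R) (hx₁ : Function.Injective x₁) (β : ι → Γ)
    (hover : ∀ x, D₁.IsOver D (x₁ x) T (β x))
    (hcover : ∀ γ : Γ, ∃ x, ∃ δ : Γ₁, ∃ c ∈ Subgroup.centralizer {(T : Γ)},
      (γ : PSL2C) = δ * β x * (c : Γ)) {s : ℂ} (hs : 1 < s.re) (p : ℕ × ℕ) :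
    ∑ x, (D₁.indices (x₁ x) p).card • ‖eulerWeight s p.1 p.2 ((D₁.a (x₁ x) : ℂ) ^ 2)‖ₑ ≤
      (D.indices T p).card • ‖eulerWeight s p.1 p.2 ((D.a T : ℂ) ^ 2)‖ₑ := by
  obtain ⟨e, i, he, hu, hroots⟩ := exists_map_t_eq_sum_nthRoots hle x₁ hx₁ β hover hcover
  have hcard := congrArg Multiset.card (hroots p)
  simp only [Multiset.card_map, Finset.card_val, Multiset.card_sum,
    card_nthRoots_complex (he _), Finset.sum_const, smul_eq_mul] at hcard
  have hle1 : ∀ x, ‖eulerWeight s p.1 p.2 ((D₁.a (x₁ x) : ℂ) ^ 2)‖ₑ ≤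
      ‖eulerWeight s p.1 p.2 ((D.a T : ℂ) ^ 2)‖ₑ := by
    intro x
    rw [enorm_le_iff_norm_le, hu, norm_mul, norm_pow, norm_zpow, selected, norm_zpow, norm_pow,
      norm_zeta_eq_one, one_pow, one_zpow, one_zpow, mul_one]
    exact pow_le_of_le_one (norm_nonneg _) (norm_eulerWeight_le_one hs _ _ (D.one_lt_norm_sq T))
      (he x).ne'
  calc _ ≤ ∑ x, ((D₁.indices (x₁ x) p).card * e x) •
        ‖eulerWeight s p.1 p.2 ((D.a T : ℂ) ^ 2)‖ₑ := by
        refine Finset.sum_le_sum fun x _ => ?_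
        exact (nsmul_le_nsmul_right (hle1 x) _).trans
          (nsmul_le_nsmul_left zero_le (Nat.le_mul_of_pos_right _ (he x)))
    _ = _ := by rw [Finset.sum_nsmul_assoc, ← hcard]

theorem localFactor_eq_prod [FiniteDimensional ℂ V] (hle : Γ₁ ≤ Γ) {T : D.R} {ι : Type*}
    [Fintype ι] (x₁ : ι → D₁.R) (hx₁ : Function.Injective x₁) (β : ι → Γ)
    (hover : ∀ x, D₁.IsOver D (x₁ x) T (β x))
    (hcover : ∀ γ : Γ, ∃ x, ∃ δ : Γ₁, ∃ c ∈ Subgroup.centralizer {(T : Γ)},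
      (γ : PSL2C) = δ * β x * (c : Γ)) (s : ℂ) :
    D.localFactor s T = ∏ x, D₁.localFactor s (x₁ x) := by
  refine (D.hasProd_pairFactor s T).unique ?_
  rw [funext (pairFactor_eq_prod hle x₁ hx₁ β hover hcover s)]
  exact hasProd_prod fun x _ => D₁.hasProd_pairFactor s (x₁ x)

end Comparison

end EulerSystem

/-! ### Absolute convergence -/

namespace EulerSystem

section Convergence

variable {W : Type*} [NormedAddCommGroup W] [InnerProductSpace ℂ W]
  {Γ : Subgroup PSL2C} {ρ : Γ →* (W ≃ₗᵢ[ℂ] W)}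

/-- Eigenvalues have modulus one, so only their number enters; in `[0, ∞]` the sums may be
interchanged freely. -/
theorem convergesAbsolutely_iff (D : EulerSystem Γ ρ) (s : ℂ) : D.ConvergesAbsolutely s ↔
    ∑' T : D.R, ∑' p : ℕ × ℕ,
      (D.indices T p).card • ‖eulerWeight s p.1 p.2 ((D.a T : ℂ) ^ 2)‖ₑ ≠ ⊤ := by
  have h1 : D.ConvergesAbsolutely s ↔
      ∑' q : (Σ T : D.R, Σ j : Fin (Module.finrank ℂ W), D.Pairs T j),
        ‖D.term s q.1 q.2.1 q.2.2.1.1 q.2.2.1.2‖ₑ ≠ ⊤ := by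
    simp only [enorm_eq_nnnorm]
    rw [ENNReal.tsum_coe_ne_top_iff_summable, ← NNReal.summable_coe]
    rfl
  rw [h1, ENNReal.tsum_sigma']
  refine not_congr (Eq.congr_left (tsum_congr fun T => ?_))
  have h2 : ∀ j, ∑' p : D.Pairs T j, ‖D.term s T j p.1.1 p.1.2‖ₑ =
      ∑' p : ℕ × ℕ, if j ∈ D.indices T p then ‖eulerWeight s p.1 p.2 ((D.a T : ℂ) ^ 2)‖ₑ
        else 0 := by
    intro j
    refine (tsum_subtype {p : ℕ × ℕ | D.c T j p.1 p.2 = 1}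
      (fun p => ‖D.term s T j p.1 p.2‖ₑ)).trans (tsum_congr fun p => ?_)
    have hn : ‖D.term s T j p.1 p.2‖ₑ = ‖eulerWeight s p.1 p.2 ((D.a T : ℂ) ^ 2)‖ₑ := by
      rw [← ofReal_norm, ← ofReal_norm, norm_term]
    simp only [Set.indicator_apply, Set.mem_ofPred_eq, c_eq_one_iff, mem_indices, hn]
  rw [ENNReal.tsum_sigma']
  simp only [h2]
  rw [ENNReal.tsum_comm]
  refine tsum_congr fun p => ?_
  rw [tsum_fintype, ← Finset.sum_filter, Finset.sum_const, Finset.filter_mem_eq_inter,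
    Finset.univ_inter]

theorem ConvergesAbsolutely.converges {D : EulerSystem Γ ρ} {s : ℂ}
    (h : D.ConvergesAbsolutely s) : D.Converges s := by
  have hfiber : ∀ T : D.R, HasProd (fun q : (Σ j : Fin (Module.finrank ℂ W), D.Pairs T j) =>
      1 - D.term s T q.1 q.2.1.1 q.2.1.2) (D.localFactor s T) := by
    intro T
    have hT : Summable fun q : (Σ j : Fin (Module.finrank ℂ W), D.Pairs T j) =>
        ‖D.term s T q.1 q.2.1.1 q.2.1.2‖ := Summable.sigma_factor h T
    have hprod := (multipliable_one_sub_of_summable hT).hasProd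
    have hsigma := hprod.sigma fun j => (D.multipliable_pairs s T j).hasProd
    have heq := hsigma.unique (hasProd_fintype _)
    rw [heq] at hprod
    exact hprod
  have hall := (multipliable_one_sub_of_summable
    (f := fun q : (Σ T : D.R, Σ j : Fin (Module.finrank ℂ W), D.Pairs T j) =>
      D.term s q.1 q.2.1 q.2.2.1.1 q.2.2.1.2) h).hasProd
  exact (hall.sigma hfiber).multipliable

end Convergence

/-! ### Regrouping the Euler products along the fibration of reduced systems -/

section Comparison

variable {V : Type*} [NormedAddCommGroup V] [InnerProductSpace ℂ V]
  {Γ₁ Γ : Subgroup PSL2C} {χ : Γ₁ →* (V ≃ₗᵢ[ℂ] V)} {n : ℕ} {α : Fin n → Γ}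
  {hα : IsRightCosetReps Γ₁ Γ α}

/-- The map from the system of `Γ₁` to that of `Γ` that sends `T₁` to the element with a
`Γ`-equivalent oriented axis; its fibres are finite and parametrize the double cosets
`Γ₁ β C(T)`. -/
theorem exists_fibration (hΓ : IsKleinian Γ) (hle : Γ₁ ≤ Γ)
    (hindex : (Γ₁.subgroupOf Γ).index ≠ 0) (D₁ : EulerSystem Γ₁ χ)
    (D : EulerSystem Γ (inducedRep hα χ)) :
    ∃ (π : D₁.R → D.R) (β : D₁.R → Γ),
      (∀ T (x : {x // π x = T}), D₁.IsOver D x T (β x)) ∧ ∀ T, Finite {x // π x = T} ∧ ∀ γ : Γ, ∃ x : {x // π x = T}, ∃ δ : Γ₁,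
        ∃ c ∈ Subgroup.centralizer {(T : Γ)}, (γ : PSL2C) = δ * β x * (c : Γ) := by
  choose π β h using D₁.exists_isOver hΓ hle D
  have hover : ∀ T (x : {x // π x = T}), D₁.IsOver D x T (β x) := by
    rintro _ ⟨x, rfl⟩
    exact h x
  refine ⟨π, β, hover, fun T => ⟨?_, fun γ => ?_⟩⟩
  -- The fibre injects into the `n` right cosets: if `β x` and `β x'` lie in the same coset, then
  -- `x` and `x'` have `Γ₁`-equivalent axes.
  · choose k hk _ using fun x : {x // π x = T} => hα (β x)
    refine Finite.of_injective k fun x x' hxx' => Subtype.ext ?_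
    have h1 := Γ₁.mul_mem (hk x') (Γ₁.inv_mem (hk x))
    rw [hxx'] at h1
    refine (hover T x).eq_of_mem (hover T x') (δ := ⟨_, h1⟩) (one_mem _) ?_
    simp [mul_assoc]
  · obtain ⟨T₁, δ, hT₁⟩ := exists_isOver_mul hΓ hle hindex D₁ D T γ
    have hπ : π T₁ = T := (h T₁).unique hT₁
    have hβ : D₁.IsOver D T₁ T (β T₁) := hover T ⟨T₁, hπ⟩
    refine ⟨⟨T₁, hπ⟩, δ⁻¹, (β T₁)⁻¹ * (⟨δ, hle δ.2⟩ * γ), ?_, ?_⟩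
    · rw [(D.diagonalizes T).mem_centralizer_iff]
      have := torus.mul_mem (torus.inv_mem hβ) hT₁
      convert this using 1
      simp [mul_assoc]
    · simp [mul_assoc]

variable [FiniteDimensional ℂ V]

theorem hasProd_localFactor_inducedRep (hΓ : IsKleinian Γ) (hle : Γ₁ ≤ Γ)
    (hindex : (Γ₁.subgroupOf Γ).index ≠ 0) (D₁ : EulerSystem Γ₁ χ)
    (D : EulerSystem Γ (inducedRep hα χ)) {s z : ℂ} (h : HasProd (D₁.localFactor s) z) :
    HasProd (D.localFactor s) z := by
  obtain ⟨π, β, hover, hfib⟩ := exists_fibration hΓ hle hindex D₁ D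
  have h' := (Equiv.sigmaFiberEquiv π).hasProd_iff.mpr h
  refine h'.sigma fun T => ?_
  have := (hfib T).1
  have := Fintype.ofFinite {x // π x = T}
  rw [localFactor_eq_prod hle (fun x : {x // π x = T} => (x : D₁.R)) Subtype.val_injective
    (fun x => β x) (hover T) (hfib T).2 s]
  exact hasProd_fintype _

theorem convergesAbsolutely_of_inducedRep (hΓ : IsKleinian Γ) (hle : Γ₁ ≤ Γ)
    (hindex : (Γ₁.subgroupOf Γ).index ≠ 0) (D₁ : EulerSystem Γ₁ χ)
    (D : EulerSystem Γ (inducedRep hα χ)) {s : ℂ} (hs : 1 < s.re)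
    (h : D.ConvergesAbsolutely s) : D₁.ConvergesAbsolutely s := by
  obtain ⟨π, β, hover, hfib⟩ := exists_fibration hΓ hle hindex D₁ D
  rw [convergesAbsolutely_iff] at h ⊢
  refine ne_top_of_le_ne_top h ?_
  rw [← (Equiv.sigmaFiberEquiv π).tsum_eq, ENNReal.tsum_sigma']
  refine ENNReal.tsum_le_tsum fun T => ?_
  rw [ENNReal.tsum_comm]
  refine ENNReal.tsum_le_tsum fun p => ?_
  have := (hfib T).1
  have := Fintype.ofFinite {x // π x = T}
  rw [tsum_fintype]
  exact sum_card_mul_norm_le hle (fun x : {x // π x = T} => (x : D₁.R)) Subtype.val_injective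
    (fun x => β x) (hover T) (hfib T).2 hs p

end Comparison

end EulerSystem

theorem mainTheorem1 {V : Type*} [NormedAddCommGroup V] [InnerProductSpace ℂ V]
    [FiniteDimensional ℂ V] (Γ Γ₁ : Subgroup PSL2C) (hΓ : IsKleinian Γ) (hle : Γ₁ ≤ Γ)
    (hnormal : (Γ₁.subgroupOf Γ).Normal) (n : ℕ) (hn : n ≠ 0)
    (hindex : (Γ₁.subgroupOf Γ).index = n) (χ : Γ₁ →* (V ≃ₗᵢ[ℂ] V))
    (α : Fin n → Γ) (hα : IsRightCosetReps Γ₁ Γ α) (s : ℂ) (hs : 1 < s.re) :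
    Nonempty (EulerSystem Γ₁ χ) ∧ Nonempty (EulerSystem Γ (inducedRep hα χ)) ∧
      ∀ (D₁ : EulerSystem Γ₁ χ) (D : EulerSystem Γ (inducedRep hα χ)),
        (D₁.Converges s → D.Converges s ∧ D₁.zeta s = D.zeta s) ∧
        (D.ConvergesAbsolutely s → D₁.ConvergesAbsolutely s ∧ D₁.zeta s = D.zeta s) := by
  refine ⟨EulerSystem.nonempty Γ₁ χ, EulerSystem.nonempty Γ _, fun D₁ D => ?_⟩
  have key : D₁.Converges s → D.Converges s ∧ D₁.zeta s = D.zeta s := fun h => by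
    have h' := D₁.hasProd_localFactor_inducedRep hΓ hle (hindex ▸ hn) D h.hasProd
    exact ⟨h'.multipliable, h'.tprod_eq.symm⟩
  refine ⟨key, fun h => ?_⟩
  -- Absolute convergence descends to `Γ₁` by domination; equality of the values then comes from the
  -- first part.
  have h₁ := D₁.convergesAbsolutely_of_inducedRep hΓ hle (hindex ▸ hn) D hs h
  exact ⟨h₁, (key h₁.converges).2⟩
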